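/- Let $\mathfrak g$ be a complex semisimple Lie algebra with Cartan matrix $(a_{ij})$, $d_i=(\alpha_i,\alpha_i)/2$ positive integers with $d_ia_{ij}=(\alpha_i,\alpha_j)$, and let $k=\mathbb C(q)$, $q_i=q^{d_i}$. Let $U=U_q(\mathfrak g)$ be the $k$-algebra with generators $x_i,y_i,t_i^{\pm1}$ and relations: the $t_i^{\pm 1}$ commute, $t_ix_j=q^{(\alpha_i,\alpha_j)}x_jt_i$, $t_iy_j=q^{-(\alpha_i,\alpha_j)}y_jt_i$, $x_iy_j-y_jx_i=\delta_{ij}(t_i-t_i^{-1})/(q_i-q_i^{-1})$, and the quantum Serre relations for the $x_i$ and for the $y_i$. It is a Hopf algebra with $\Delta(t_i)=t_i\otimes t_i$, $\Delta(x_i)=x_i\otimes1+t_i\otimes x_i$, $\Delta(y_i)=y_i\otimes t_i^{-1}+1\otimes y_i$, counit $\epsilon(t_i)=1$, $\epsilon(x_i)=\epsilon(y_i)=0$, and antipode $\sigma(t_i)=t_i^{-1}$, $\sigma(x_i)=-t_i^{-1}x_i$, $\sigma(y_i)=-y_it_i$. Let $U^{op}$ be the Hopf algebra with the opposite multiplication,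 the same comultiplication and counit, and antipode $\sigma^{-1}$; $U\otimes U^{op}$ is the tensor product Hopf algebra. For a Hopf algebra $H$ over $k$ put $(\mathrm{ad}\,a)b=\sum a_{(1)}b\,\sigma(a_{(2)})$ and $F(H)=\{v\in H:\dim (\mathrm{ad}\,H)v<\infty\}$; this is an $\mathrm{ad}\,H$-stable subalgebra of $H$ with $\Delta(F(H))\subseteq H\otimes F(H)$. Let $\psi:U\to U\otimes U^{op}$ be the algebra map $\psi(u)=\sum u_{(1)}\otimes\sigma(u_{(2)})$. An $F(U)$-bimodule with compatible $\mathrm{ad}\,U$-action is a $k$-vector space $M$ with commuting $k$-linear left and right actions of $F(U)$ and a $U$-module structure $(a,m)\mapsto(\mathrm{ad}\,a)m$ such that $$(\mathrm{ad}\,a)(b\cdot m\cdot c)=\sum(\mathrm{ad}\,a_{(1)})b\cdot(\mathrm{ad}\,a_{(2)})m\cdot(\mathrm{ad}\,a_{(3)})c\qquad(a\in U,\ b,c\in F(U),\ m\in M),$$ $$\sum\big((\mathrm{ad}\,a_{(1)})m\big)\cdot a_{(2)}=a\cdot m\qquad(a\in F(U),\ m\in M).$$ Theorem. The set $A=F(U\otimes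 U^{op})\psi(U)$ of all sums of products $fr$ with $f\in F(U\otimes U^{op})$, $r\in\psi(U)$ is a subalgebra of $U\otimes U^{op}$, and $F(U)$-bimodules with compatible $\mathrm{ad}\,U$-action are the same as $A$-modules. Precisely: for every $k$-vector space $M$ there is a bijection between the structures of $F(U)$-bimodule with compatible $\mathrm{ad}\,U$-action on $M$ and the $A$-module structures on $M$ (extending the $k$-vector space structure), such that for corresponding structures $$(a\otimes b)m=a\cdot m\cdot b\quad(a,b\in F(U)),\qquad \psi(c)m=(\mathrm{ad}\,c)m\quad(c\in U);$$ in particular $a\otimes b\in A$ for $a,b\in F(U)$. Moreover a $k$-linear map between two such spaces is $A$-linear if and only if it commutes with both $F(U)$-actions and the $\mathrm{ad}\,U$-action. -/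

import Mathlib

open scoped TensorProduct

noncomputable section

namespace HopfAd

section Convolution

variable {k C A : Type*} [CommRing k] [AddCommGroup C] [Module k C] [Coalgebra k C]
  [Ring A] [Algebra k A]

variable (k C) in
/-- The constant `a ↦ ε(a) t`, as an element of the convolution algebra. -/
def const (t : A) : WithConv (C →ₗ[k] A) :=
  WithConv.toConv (LinearMap.toSpanSingleton k A t ∘ₗ Coalgebra.counit)

theorem const_mul (t : A) (f : WithConv (C →ₗ[k] A)) (a : C) :
    (const k C t * f).ofConv a = t * f.ofConv a := by
  rw [(Coalgebra.Repr.arbitrary k a).convMul_apply]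
  conv_rhs => rw [← Coalgebra.sum_counit_smul (Coalgebra.Repr.arbitrary k a)]
  simp [const, Finset.mul_sum]

theorem mul_const (t : A) (f : WithConv (C →ₗ[k] A)) (a : C) :
    (f * const k C t).ofConv a = f.ofConv a * t := by
  have h := congrArg (TensorProduct.lift ((LinearMap.lsmul k C).flip))
    (Coalgebra.sum_tmul_counit_eq (Coalgebra.Repr.arbitrary k a))
  rw [(Coalgebra.Repr.arbitrary k a).convMul_apply]
  simp only [map_sum, TensorProduct.lift.tmul, LinearMap.flip_apply, LinearMap.lsmul_apply,
    one_smul] at h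
  conv_rhs => rw [← h]
  simp [const, Finset.sum_mul]

theorem const_mul_const (s t : A) : const k C (s * t) = const k C s * const k C t := by
  ext a
  rw [const_mul]
  simp [const]

end Convolution

variable (k : Type*) {H : Type*} [Field k] [Ring H] [HopfAlgebra k H]

variable (H) in
/-- The algebra map `u ↦ ∑ u₍₁₎ ⊗ σ(u₍₂₎)` from `H` to `H ⊗ Hᵒᵖ`. -/
def psi : H →ₐ[k] H ⊗[k] Hᵐᵒᵖ :=
  (Algebra.TensorProduct.map (AlgHom.id k H) (HopfAlgebra.antipodeAlgHomOp k H)).comp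
    (Bialgebra.comulAlgHom k H)

variable (H) in
/-- The left adjoint action `(ad a) b = ∑ a₍₁₎ b σ(a₍₂₎)` (see `ad_apply`). -/
def ad : H →ₐ[k] Module.End k H :=
  (AlgHom.mulLeftRight k H).comp (psi k H)

theorem ad_apply {ι : Type*} {a : H} (r : Coalgebra.Repr k a ι) (b : H) :
    ad k H a b = ∑ i ∈ r.index, r.left i * b * HopfAlgebra.antipode k (r.right i) := by
  simp only [ad, psi, AlgHom.comp_apply, Bialgebra.comulAlgHom_apply, ← r.eq, map_sum,
    Algebra.TensorProduct.map_tmul, LinearMap.sum_apply, AlgHom.mulLeftRight_apply]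
  simp

theorem ad_eq_conv (b a : H) :
    ad k H a b = (WithConv.toConv LinearMap.id * const k H b *
      WithConv.toConv (HopfAlgebra.antipode k)).ofConv a := by
  rw [ad_apply k (Coalgebra.Repr.arbitrary k a), (Coalgebra.Repr.arbitrary k a).convMul_apply]
  simp only [mul_const, LinearMap.id_apply]

theorem ad_mul_apply {ι : Type*} {a : H} (r : Coalgebra.Repr k a ι) (b c : H) :
    ad k H a (b * c) = ∑ i ∈ r.index, ad k H (r.left i) b * ad k H (r.right i) c := by
  simp only [ad_eq_conv]
  rw [← r.convMul_apply, const_mul_const]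
  congr 2
  rw [mul_assoc (_ * const k H b), ← mul_assoc (WithConv.toConv (HopfAlgebra.antipode k)),
    ← mul_assoc (WithConv.toConv (HopfAlgebra.antipode k)), LinearMap.antipode_mul_id]
  simp only [one_mul, mul_assoc]

theorem ad_one (a : H) : ad k H a 1 = algebraMap k H (Coalgebra.counit a) := by
  rw [ad_apply k (Coalgebra.Repr.arbitrary k a)]
  simp [HopfAlgebra.sum_mul_antipode_eq_algebraMap_counit]

/-- The subspace `(ad H) v`. -/
def adOrbit (v : H) : Submodule k H := LinearMap.range ((ad k H).toLinearMap.flip v)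

theorem ad_mem_adOrbit (a v : H) : ad k H a v ∈ adOrbit k v := ⟨a, rfl⟩

variable (H) in
/-- The locally finite part `F(H)`: all `v` such that `(ad H) v` is finite-dimensional. -/
def locallyFinite : Subalgebra k H where
  carrier := {v | FiniteDimensional k (adOrbit k v)}
  mul_mem' {b c} hb hc := by
    simp only [Set.mem_ofPred_eq] at hb hc ⊢
    have h : (adOrbit k b * adOrbit k c).FG :=
      Submodule.FG.mul (Module.Finite.iff_fg.1 hb) (Module.Finite.iff_fg.1 hc)
    have := Module.Finite.iff_fg.2 h
    refine Submodule.finiteDimensional_of_le (S₂ := adOrbit k b * adOrbit k c) ?_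
    rintro _ ⟨a, rfl⟩
    change ad k H a (b * c) ∈ _
    rw [ad_mul_apply k (Coalgebra.Repr.arbitrary k a)]
    exact Submodule.sum_mem _ fun i _ =>
      Submodule.mul_mem_mul (ad_mem_adOrbit k _ _) (ad_mem_adOrbit k _ _)
  add_mem' {b c} hb hc := by
    simp only [Set.mem_ofPred_eq] at hb hc ⊢
    refine Submodule.finiteDimensional_of_le (S₂ := adOrbit k b ⊔ adOrbit k c) ?_
    rintro _ ⟨a, rfl⟩
    change ad k H a (b + c) ∈ _
    rw [map_add]
    exact Submodule.add_mem_sup (ad_mem_adOrbit k _ _) (ad_mem_adOrbit k _ _)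
  algebraMap_mem' r := by
    refine Submodule.finiteDimensional_of_le (S₂ := Submodule.span k {(1 : H)}) ?_
    rintro _ ⟨a, rfl⟩
    change ad k H a (algebraMap k H r) ∈ _
    rw [Algebra.algebraMap_eq_smul_one, map_smul, ad_one, Algebra.algebraMap_eq_smul_one]
    exact Submodule.smul_mem _ _ (Submodule.smul_mem _ _ (Submodule.mem_span_singleton_self _))

theorem mem_locallyFinite {v : H} :
    v ∈ locallyFinite k H ↔ FiniteDimensional k (adOrbit k v) := Iff.rfl

theorem ad_mem_locallyFinite (a : H) {v : H} (hv : v ∈ locallyFinite k H) :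
    ad k H a v ∈ locallyFinite k H := by
  rw [mem_locallyFinite] at hv ⊢
  refine Submodule.finiteDimensional_of_le (S₂ := adOrbit k v) ?_
  rintro _ ⟨b, rfl⟩
  change ad k H b (ad k H a v) ∈ _
  rw [← Module.End.mul_apply, ← map_mul]
  exact ad_mem_adOrbit k _ _

variable (H) in
/-- The adjoint action of `H` on `F(H)`. -/
def adF : H →ₗ[k] locallyFinite k H →ₗ[k] locallyFinite k H :=
  LinearMap.mk₂ k (fun a v => ⟨ad k H a v, ad_mem_locallyFinite k a v.2⟩)
    (fun a b v => Subtype.ext (by simp)) (fun c a v => Subtype.ext (by simp))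
    (fun a v w => Subtype.ext (by simp)) (fun c a v => Subtype.ext (by simp))

@[simp]
theorem coe_adF (a : H) (v : locallyFinite k H) : (adF k H a v : H) = ad k H a v := rfl


open WithConv in
theorem conv_antipode_mul {A : Type*} [Ring A] [Algebra k A] (f : H →ₐ[k] A) :
    toConv (f.toLinearMap ∘ₗ HopfAlgebra.antipode k) * toConv f.toLinearMap = 1 := by
  have h := LinearMap.algHom_comp_convMul_distrib f
    (toConv (HopfAlgebra.antipode k (A := H))) (toConv (LinearMap.id (M := H)))
  rw [LinearMap.antipode_mul_id] at h
  refine WithConv.ext (Eq.trans h.symm ?_)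
  ext a
  simp [LinearMap.convOne_def]

open WithConv in
theorem conv_mul_antipode {A : Type*} [Ring A] [Algebra k A] (f : H →ₐ[k] A) :
    toConv f.toLinearMap * toConv (f.toLinearMap ∘ₗ HopfAlgebra.antipode k) = 1 := by
  have h := LinearMap.algHom_comp_convMul_distrib f
    (toConv (LinearMap.id (M := H))) (toConv (HopfAlgebra.antipode k (A := H)))
  rw [LinearMap.id_mul_antipode] at h
  refine WithConv.ext (Eq.trans h.symm ?_)
  ext a
  simp [LinearMap.convOne_def]

open WithConv Algebra.TensorProduct in
/-- `∑ (σ(a₍₁₎) ⊗ 1) Δ((ad a₍₂₎) v) (a₍₃₎ ⊗ 1) = ∑ v₍₁₎ ⊗ (ad a) v₍₂₎`. -/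
theorem conv_comul_ad (v : H) (a : H) :
    (toConv ((includeLeft (R := k) (S := k) (A := H) (B := H)).toLinearMap ∘ₗ
        HopfAlgebra.antipode k) *
      toConv (Coalgebra.comul ∘ₗ (ad k H).toLinearMap.flip v) *
      toConv (includeLeft (R := k) (S := k) (A := H) (B := H)).toLinearMap).ofConv a =
    (ad k H a).lTensor H (Coalgebra.comul v) := by
  let i1 : H →ₐ[k] H ⊗[k] H := includeLeft
  let i2 : H →ₐ[k] H ⊗[k] H := includeRight
  let D := Bialgebra.comulAlgHom k H
  let S := HopfAlgebra.antipode k (A := H)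
  let c := const k H (Coalgebra.comul (R := k) v)
  have hD : toConv D.toLinearMap = toConv i1.toLinearMap * toConv i2.toLinearMap := by
    ext a
    rw [(Coalgebra.Repr.arbitrary k a).convMul_apply]
    simp [D, i1, i2, ← (Coalgebra.Repr.arbitrary k a).eq]
  have hA : toConv (Coalgebra.comul ∘ₗ (ad k H).toLinearMap.flip v) =
      toConv D.toLinearMap * c * toConv (D.toLinearMap ∘ₗ S) := by
    ext a
    rw [(Coalgebra.Repr.arbitrary k a).convMul_apply]
    change D (ad k H a v) = _
    rw [ad_apply k (Coalgebra.Repr.arbitrary k a), map_sum]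
    simp only [mul_const, c, map_mul]
    rfl
  have h1 : toConv (Coalgebra.comul ∘ₗ (ad k H).toLinearMap.flip v) * toConv i1.toLinearMap =
      toConv i1.toLinearMap * (toConv i2.toLinearMap * c * toConv (i2.toLinearMap ∘ₗ S)) := by
    calc _ = toConv (Coalgebra.comul ∘ₗ (ad k H).toLinearMap.flip v) *
          (toConv i1.toLinearMap * toConv i2.toLinearMap) * toConv (i2.toLinearMap ∘ₗ S) := by
          simp only [mul_assoc, conv_mul_antipode, S, mul_one]
      _ = _ := by
          rw [← hD, hA, mul_assoc _ (toConv (D.toLinearMap ∘ₗ S)), conv_antipode_mul, mul_one, hD]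
          simp only [mul_assoc]
  rw [mul_assoc]
  change (toConv (i1.toLinearMap ∘ₗ S) * (_ * toConv i1.toLinearMap)).ofConv a = _
  rw [h1, ← mul_assoc, conv_antipode_mul, one_mul,
    (Coalgebra.Repr.arbitrary k a).convMul_apply]
  simp only [mul_const, c, S, i2]
  induction (Coalgebra.comul (R := k) v : H ⊗[k] H) with
  | zero => simp
  | tmul x y => simp [ad_apply k (Coalgebra.Repr.arbitrary k a), TensorProduct.tmul_sum]
  | add s t hs ht => rw [map_add, ← hs, ← ht]; simp only [mul_add, add_mul, Finset.sum_add_distrib]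

theorem mem_range_of_contract (W : Submodule k H) (t : H ⊗[k] H)
    (h : ∀ f : H →ₗ[k] k, TensorProduct.lid k H (f.rTensor H t) ∈ W) :
    t ∈ LinearMap.range (W.subtype.lTensor H) := by
  classical
  let b := Module.Free.chooseBasis k H
  have ht : t = (TensorProduct.equivFinsuppOfBasisLeft b).symm
    (TensorProduct.equivFinsuppOfBasisLeft b t) := by simp
  rw [ht, TensorProduct.equivFinsuppOfBasisLeft_symm_apply]
  refine Submodule.sum_mem _ fun i _ => ?_
  have hi : TensorProduct.equivFinsuppOfBasisLeft (N := H) b t i ∈ W := by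
    convert h (b.coord i) using 1
    exact TensorProduct.equivFinsuppOfBasisLeft_apply _ _ _
  exact ⟨b i ⊗ₜ ⟨_, hi⟩, by simp⟩

theorem contract_mem (W : Submodule k H) (f : H →ₗ[k] k) {t : H ⊗[k] H}
    (ht : t ∈ LinearMap.range (W.subtype.lTensor H)) :
    TensorProduct.lid k H (f.rTensor H t) ∈ W := by
  obtain ⟨s, rfl⟩ := ht
  induction s with
  | zero => simp
  | tmul x y => simpa using W.smul_mem _ y.2
  | add s t hs ht => simpa only [map_add] using W.add_mem hs ht

theorem mul_mem_range (W : Submodule k H) (x y : H) {t : H ⊗[k] H}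
    (ht : t ∈ LinearMap.range (W.subtype.lTensor H)) :
    (x ⊗ₜ[k] 1) * t * (y ⊗ₜ[k] 1) ∈ LinearMap.range (W.subtype.lTensor H) := by
  obtain ⟨s, rfl⟩ := ht
  induction s with
  | zero => simp
  | tmul u w => exact ⟨(x * u * y) ⊗ₜ w, by simp⟩
  | add s t hs ht => simpa only [map_add, mul_add, add_mul] using Submodule.add_mem _ hs ht

/-- The locally finite part is a left coideal: `Δ(F(H)) ⊆ H ⊗ F(H)`. -/
theorem comul_mem_range {v : H} (hv : v ∈ locallyFinite k H) :
    (Coalgebra.comul v : H ⊗[k] H) ∈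
      LinearMap.range ((locallyFinite k H).toSubmodule.subtype.lTensor H) := by
  have hfg := Module.Finite.iff_fg.1 ((mem_locallyFinite k).1 hv)
  obtain ⟨s, hs⟩ := hfg
  obtain ⟨V, hV, hsV⟩ := TensorProduct.exists_finite_submodule_right_of_setFinite
    ((fun w : H => (Coalgebra.comul w : H ⊗[k] H)) '' (s : Set H)) (s.finite_toSet.image _)
  have hW : ∀ w ∈ adOrbit k v,
      (Coalgebra.comul w : H ⊗[k] H) ∈ LinearMap.range (V.subtype.lTensor H) := by
    intro w hw
    rw [← hs] at hw
    have : Submodule.span k (s : Set H) ≤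
        (LinearMap.range (V.subtype.lTensor H)).comap (Coalgebra.comul (R := k) (A := H)) :=
      Submodule.span_le.2 fun x hx => hsV ⟨x, hx, rfl⟩
    exact this hw
  have key (a : H) : (ad k H a).lTensor H (Coalgebra.comul v) ∈
      LinearMap.range (V.subtype.lTensor H) := by
    rw [← conv_comul_ad, (Coalgebra.Repr.arbitrary k a).convMul_apply]
    refine Submodule.sum_mem _ fun i _ => ?_
    rw [(Coalgebra.Repr.arbitrary k _).convMul_apply, Finset.sum_mul]
    refine Submodule.sum_mem _ fun j _ => ?_
    exact mul_mem_range k V _ _ (hW _ (ad_mem_adOrbit k _ _))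
  refine mem_range_of_contract k _ _ fun f => ?_
  change _ ∈ locallyFinite k H
  rw [mem_locallyFinite]
  refine Submodule.finiteDimensional_of_le (S₂ := V) ?_
  rintro _ ⟨a, rfl⟩
  change ad k H a _ ∈ V
  have h := contract_mem k V f (key a)
  have e (t : H ⊗[k] H) : TensorProduct.lid k H (f.rTensor H ((ad k H a).lTensor H t)) =
      ad k H a (TensorProduct.lid k H (f.rTensor H t)) := by
    induction t with
    | zero => simp
    | tmul x y => simp
    | add s t hs ht => simp only [map_add, hs, ht]
  rwa [e] at h

variable (H) in
/-- An `F(H)`-bimodule structure (left and right actions of the `k`-algebra `F(H)`, commuting with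
each other) on the `k`-vector space `M`, together with a compatible `ad H`-module structure.
In Sweedler notation the compatibility conditions are
`(ad a)(b · m · c) = ∑ (ad a₍₁₎)b · (ad a₍₂₎)m · (ad a₍₃₎)c` for `a ∈ H`, `b, c ∈ F(H)`, and
`∑ ((ad a₍₁₎)m) · a₍₂₎ = a · m` for `a ∈ F(H)`, where `∑ a₍₁₎ ⊗ a₍₂₎ = Δ(a) ∈ H ⊗ F(H)`
(see `comul_mem_range`). -/
structure CompatibleBimodule (M : Type*) [AddCommGroup M] [Module k M] where
  /-- the left action: `a · m = left a m` -/
  left : locallyFinite k H →ₐ[k] Module.End k M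
  /-- the right action: `m · b = right (op b) m` -/
  right : (locallyFinite k H)ᵐᵒᵖ →ₐ[k] Module.End k M
  /-- the action of `ad H` -/
  adj : H →ₐ[k] Module.End k M
  left_right_comm : ∀ (a b : locallyFinite k H) (m : M),
    left a (right (.op b) m) = right (.op b) (left a m)
  adj_bimodule : ∀ (a : H) (b c : locallyFinite k H) (m : M) {n : ℕ} (x y z : Fin n → H),
    ∑ i, x i ⊗ₜ[k] (y i ⊗ₜ[k] z i) = Coalgebra.comul.lTensor H (Coalgebra.comul a) →
    adj a (left b (right (.op c) m)) =
      ∑ i, left (adF k H (x i) b) (right (.op (adF k H (z i) c)) (adj (y i) m))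
  adj_right : ∀ (a : locallyFinite k H) (m : M) {n : ℕ} (x : Fin n → H)
    (y : Fin n → locallyFinite k H),
    ∑ i, x i ⊗ₜ[k] (y i : H) = Coalgebra.comul (a : H) →
    ∑ i, right (.op (y i)) (adj (x i) m) = left a m

/-- The `k`-linear maps between bimodules with compatible `ad H`-action that commute with all
three actions. -/
structure CompatibleBimodule.IsHom {M N : Type*} [AddCommGroup M] [Module k M] [AddCommGroup N]
    [Module k N] (B : CompatibleBimodule k H M) (B' : CompatibleBimodule k H N)
    (f : M →ₗ[k] N) : Prop where
  map_left : ∀ a m, f (B.left a m) = B'.left a (f m)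
  map_right : ∀ b m, f (B.right b m) = B'.right b (f m)
  map_adj : ∀ c m, f (B.adj c m) = B'.adj c (f m)

/-- The bialgebra `Hᵒᵖ`: opposite multiplication, same comultiplication and counit. -/
instance instBialgebraOp {B : Type*} [Ring B] [Bialgebra k B] : Bialgebra k Bᵐᵒᵖ :=
  Bialgebra.mk' k Bᵐᵒᵖ
    (by simp [MulOpposite.counit_def])
    (by intro a b; simp [MulOpposite.counit_def, mul_comm])
    (by simp [MulOpposite.comul_def, Algebra.TensorProduct.one_def])
    (by
      intro a b
      induction a with | _ a
      induction b with | _ b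
      simp only [MulOpposite.comul_def, LinearMap.comp_apply, ← MulOpposite.op_mul,
        LinearEquiv.coe_coe, MulOpposite.coe_opLinearEquiv_symm, MulOpposite.unop_op,
        Bialgebra.comul_mul]
      induction (Coalgebra.comul (R := k) a : B ⊗[k] B) with
      | zero => simp
      | add s t hs ht => simp only [map_add, mul_add, add_mul, hs, ht]
      | tmul x y =>
        induction (Coalgebra.comul (R := k) b : B ⊗[k] B) with
        | zero => simp
        | add s t hs ht => simp only [map_add, mul_add, add_mul, hs, ht]
        | tmul u v => simp)

theorem comul_op {ι : Type*} {a : H} (r : Coalgebra.Repr k a ι) :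
    (Coalgebra.comul (MulOpposite.op a) : Hᵐᵒᵖ ⊗[k] Hᵐᵒᵖ) =
      ∑ i ∈ r.index, MulOpposite.op (r.left i) ⊗ₜ[k] MulOpposite.op (r.right i) := by
  simp [MulOpposite.comul_def, ← r.eq]

/-- If the antipode `σ` of `H` is bijective, then `Hᵒᵖ` is a Hopf algebra with antipode `σ⁻¹`. -/
abbrev hopfAlgebraOp (h : Function.Bijective (HopfAlgebra.antipode k (A := H))) :
    HopfAlgebra k Hᵐᵒᵖ where
  antipode := (MulOpposite.opLinearEquiv k).toLinearMap ∘ₗ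
    (LinearEquiv.ofBijective (HopfAlgebra.antipode k) h).symm.toLinearMap ∘ₗ
    (MulOpposite.opLinearEquiv k).symm.toLinearMap
  mul_antipode_rTensor_comul := by
    have hτ := (LinearEquiv.ofBijective (HopfAlgebra.antipode k (A := H)) h).apply_symm_apply
    generalize (LinearEquiv.ofBijective (HopfAlgebra.antipode k (A := H)) h).symm = τ at hτ
    refine LinearMap.ext fun a => ?_
    obtain ⟨a, rfl⟩ := MulOpposite.op_surjective a
    apply MulOpposite.unop_injective
    apply h.1
    have := HopfAlgebra.sum_mul_antipode_eq_algebraMap_counit (Coalgebra.Repr.arbitrary k a)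
    simp only [LinearEquiv.ofBijective_apply] at hτ
    simp [comul_op k (Coalgebra.Repr.arbitrary k a), HopfAlgebra.antipode_mul_antidistrib, hτ,
      this, MulOpposite.counit_def, Algebra.algebraMap_eq_smul_one]
  mul_antipode_lTensor_comul := by
    have hτ := (LinearEquiv.ofBijective (HopfAlgebra.antipode k (A := H)) h).apply_symm_apply
    generalize (LinearEquiv.ofBijective (HopfAlgebra.antipode k (A := H)) h).symm = τ at hτ
    refine LinearMap.ext fun a => ?_
    obtain ⟨a, rfl⟩ := MulOpposite.op_surjective a
    apply MulOpposite.unop_injective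
    apply h.1
    have := HopfAlgebra.sum_antipode_mul_eq_algebraMap_counit (Coalgebra.Repr.arbitrary k a)
    simp only [LinearEquiv.ofBijective_apply] at hτ
    simp [comul_op k (Coalgebra.Repr.arbitrary k a), HopfAlgebra.antipode_mul_antidistrib, hτ,
      this, MulOpposite.counit_def, Algebra.algebraMap_eq_smul_one]

end HopfAd

namespace QuantumSerre

variable {k : Type*} [Field k]

/-- The `q`-number `[m]_v = (v^m - v^{-m}) / (v - v⁻¹)`. -/
def qNum (v : k) (m : ℕ) : k := (v ^ m - (v ^ m)⁻¹) / (v - v⁻¹)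

/-- The `q`-factorial `[m]_v! = [m]_v [m-1]_v ⋯ [1]_v`. -/
def qFact (v : k) (m : ℕ) : k := ∏ j ∈ Finset.range m, qNum v (j + 1)

/-- The `q`-binomial coefficient (used only for `j ≤ m`). -/
def qBinom (v : k) (m j : ℕ) : k := qFact v m / (qFact v j * qFact v (m - j))

/-- The quantum Serre expression `∑_{m=0}^{N} (-1)^m [N choose m]_v x^{N-m} z x^m`. -/
def serre {A : Type*} [Ring A] [Algebra k A] (v : k) (N : ℕ) (x z : A) : A :=
  ∑ m ∈ Finset.range (N + 1), ((-1) ^ m * qBinom v N m) • (x ^ (N - m) * z * x ^ m)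

variable {A : Type*} [Ring A] [Algebra k A]

/-- Iterated `q`-commutators `z_{n+1} = x z_n - e u^n z_n x`. -/
def iter (u e : k) (x z : A) : ℕ → A
  | 0 => z
  | n + 1 => x * iter u e x z n - (e * u ^ n) • (iter u e x z n * x)

theorem qNum_inv (v : k) (m : ℕ) : qNum v⁻¹ m = qNum v m := by
  simp only [qNum, inv_pow, inv_inv]
  rw [← neg_sub, ← neg_sub v v⁻¹, neg_div_neg_eq]

theorem qBinom_inv (v : k) (m j : ℕ) : qBinom v⁻¹ m j = qBinom v m j := by
  simp only [qBinom, qFact, qNum_inv]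

/-- Nonvanishing of all `[n]_v`. -/
structure Generic (v : k) : Prop where
  ne_zero : v ≠ 0
  qNum_ne : ∀ n, qNum v (n + 1) ≠ 0

theorem Generic.inv {v : k} (h : Generic v) : Generic v⁻¹ :=
  ⟨inv_ne_zero h.ne_zero, fun n => by rw [qNum_inv]; exact h.qNum_ne n⟩

theorem Generic.qFact_ne {v : k} (h : Generic v) (n : ℕ) : qFact v n ≠ 0 :=
  Finset.prod_ne_zero_iff.2 fun j _ => h.qNum_ne j

theorem qFact_succ (v : k) (n : ℕ) : qFact v (n + 1) = qFact v n * qNum v (n + 1) :=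
  Finset.prod_range_succ _ _

theorem Generic.qBinom_zero {v : k} (h : Generic v) (n : ℕ) : qBinom v n 0 = 1 := by
  have := h.qFact_ne n
  rw [qBinom, Nat.sub_zero, show qFact v 0 = 1 from rfl, one_mul, div_self this]

theorem qBinom_symm {v : k} {m j : ℕ} (hj : j ≤ m) :
    qBinom v m (m - j) = qBinom v m j := by
  rw [qBinom, qBinom, Nat.sub_sub_self hj, mul_comm]

theorem Generic.qBinom_self {v : k} (h : Generic v) (n : ℕ) : qBinom v n n = 1 := by
  rw [← qBinom_symm le_rfl, Nat.sub_self, h.qBinom_zero]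

theorem Generic.pascal {v : k} (h : Generic v) {n m : ℕ} (hm : m < n) :
    qBinom v (n + 1) (m + 1) =
      (v ^ (m + 1))⁻¹ * qBinom v n (m + 1) + v ^ (n - m) * qBinom v n m := by
  obtain ⟨d, rfl⟩ := Nat.exists_eq_add_of_lt hm
  have e1 : m + d + 1 + 1 - (m + 1) = d + 1 := by omega
  have e2 : m + d + 1 - (m + 1) = d := by omega
  have e3 : m + d + 1 - m = d + 1 := by omega
  simp only [qBinom, e1, e2, e3]
  have hv := h.ne_zero
  have h1 := h.qFact_ne (m)
  have h2 := h.qFact_ne d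
  have h3 := h.qNum_ne m
  have h4 := h.qNum_ne d
  have h5 := h.qFact_ne (m + d + 1)
  rw [qFact_succ v (m + d + 1), qFact_succ v m, qFact_succ v d]
  have key : qNum v (m + d + 1 + 1) =
      (v ^ (m + 1))⁻¹ * qNum v (d + 1) + v ^ (d + 1) * qNum v (m + 1) := by
    have : v - v⁻¹ ≠ 0 := by
      intro h0
      apply h.qNum_ne 0
      simp [qNum, h0]
    simp only [qNum]
    field_simp
    ring
  rw [key]
  field_simp

theorem iter_eq {v : k} (h : Generic v) (e : k) (x z : A) (N : ℕ) :
    iter (v ^ 2) e x z N = ∑ m ∈ Finset.range (N + 1),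
      ((-1) ^ m * qBinom v N m * (e ^ m * v ^ (m * N) * (v ^ m)⁻¹)) •
        (x ^ (N - m) * z * x ^ m) := by
  have hv := h.ne_zero
  induction N with
  | zero => simp [iter, h.qBinom_zero]
  | succ N ih =>
    have hl : ∀ m ∈ Finset.range (N + 1), x * (x ^ (N - m) * z * x ^ m) =
        x ^ (N + 1 - m) * z * x ^ m := fun m hm => by
      have : N + 1 - m = N - m + 1 := by have := Finset.mem_range.1 hm; omega
      rw [this, pow_succ']; simp only [mul_assoc]
    have hr : ∀ m, x ^ (N - m) * z * x ^ m * x = x ^ (N + 1 - (m + 1)) * z * x ^ (m + 1) :=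
      fun m => by rw [Nat.add_sub_add_right, pow_succ, mul_assoc _ _ x]
    rw [iter, ih, Finset.mul_sum, Finset.sum_mul, Finset.smul_sum]
    simp only [mul_smul_comm, smul_mul_assoc, smul_smul, hr]
    rw [Finset.sum_congr rfl fun m hm => by rw [hl m hm]]
    rw [Finset.sum_range_succ' _ N, Finset.sum_range_succ _ N, Finset.sum_range_succ' _ (N + 1),
      Finset.sum_range_succ _ N, add_sub_add_comm, ← Finset.sum_sub_distrib, sub_eq_add_neg,
      add_comm (_ • _) (-_), ← add_assoc]
    congr 1
    congr 1
    · refine Finset.sum_congr rfl fun m hm => ?_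
      rw [← sub_smul]
      congr 1
      have hm' := Finset.mem_range.1 hm
      rw [h.pascal hm']
      obtain ⟨d, rfl⟩ := Nat.exists_eq_add_of_lt hm'
      have : m + d + 1 - m = d + 1 := by omega
      rw [this]
      field_simp
      ring
    · rw [← neg_smul, h.qBinom_self, h.qBinom_self]
      congr 1
      field_simp
      ring
    · simp [h.qBinom_zero]

theorem serre_eq_iter {v e : k} (h : Generic v) (x z : A) (N : ℕ) (he : e * v ^ N = v) :
    serre v N x z = iter (v ^ 2) e x z N := by
  have hv := h.ne_zero
  rw [iter_eq h, serre]
  refine Finset.sum_congr rfl fun m _ => ?_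
  rw [mul_comm m N, pow_mul, ← mul_pow, he, mul_inv_cancel₀ (pow_ne_zero _ hv), mul_one]

theorem serre_inv (v : k) (N : ℕ) (x z : A) : serre v⁻¹ N x z = serre v N x z := by
  simp only [serre, qBinom_inv]

theorem serre_add_right (v : k) (N : ℕ) (x z w : A) :
    serre v N x (z + w) = serre v N x z + serre v N x w := by
  simp only [serre, mul_add, add_mul, smul_add, Finset.sum_add_distrib]

theorem serre_zero_right (v : k) (N : ℕ) (x : A) : serre v N x 0 = 0 := by
  simp [serre]

theorem map_serre {B : Type*} [Ring B] [Algebra k B] (f : A →ₐ[k] B) (v : k) (N : ℕ) (x z : A) :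
    f (serre v N x z) = serre v N (f x) (f z) := by
  simp [serre]

theorem serre_smul (v c d : k) (N : ℕ) (x z : A) :
    serre v N (c • x) (d • z) = (c ^ N * d) • serre v N x z := by
  simp only [serre, Finset.smul_sum]
  refine Finset.sum_congr rfl fun m hm => ?_
  have : N = N - m + m := by have := Finset.mem_range.1 hm; omega
  simp only [smul_pow, smul_mul_assoc, mul_smul_comm, smul_smul]
  congr 1
  have e : c ^ N = c ^ (N - m) * c ^ m := by rw [← pow_add, ← this]
  rw [e]
  ring

theorem serre_op (v : k) (N : ℕ) (x z : A) :
    serre v N (MulOpposite.op x) (MulOpposite.op z) =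
      (-1 : k) ^ N • MulOpposite.op (serre v N x z) := by
  apply MulOpposite.unop_injective
  simp only [serre, MulOpposite.unop_smul, MulOpposite.unop_op, Finset.smul_sum]
  rw [← Finset.sum_range_reflect, Finset.unop_sum]
  refine Finset.sum_congr rfl fun m hm => ?_
  have hm' : m ≤ N := by have := Finset.mem_range.1 hm; omega
  have e1 : N + 1 - 1 - m = N - m := by omega
  simp only [e1, Nat.sub_sub_self hm', qBinom_symm hm', MulOpposite.unop_smul, MulOpposite.unop_mul,
    MulOpposite.unop_pow, MulOpposite.unop_op, smul_smul, mul_assoc]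
  congr 1
  rw [← mul_assoc]
  congr 1
  obtain ⟨d, rfl⟩ := Nat.exists_eq_add_of_le hm'
  rw [Nat.add_sub_cancel_left, pow_add, mul_right_comm, ← pow_add, ← two_mul, pow_mul]
  simp

theorem serre_tmul_left {B : Type*} [Ring B] [Algebra k B] (v : k) (N : ℕ) (x z : A) {g h : B}
    (hc : Commute g h) : serre v N (g ⊗ₜ[k] x) (h ⊗ₜ[k] z) = (g ^ N * h) ⊗ₜ[k] serre v N x z := by
  simp only [serre, TensorProduct.tmul_sum, TensorProduct.tmul_smul]
  refine Finset.sum_congr rfl fun m hm => ?_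
  have : N = N - m + m := by have := Finset.mem_range.1 hm; omega
  simp only [Algebra.TensorProduct.tmul_pow, Algebra.TensorProduct.tmul_mul_tmul]
  have e : g ^ N = g ^ (N - m) * g ^ m := by rw [← pow_add, ← this]
  rw [e, mul_assoc _ h, ← (hc.pow_left m).eq]
  simp only [mul_assoc]

theorem serre_tmul_right {B : Type*} [Ring B] [Algebra k B] (v : k) (N : ℕ) (x z : A) {g h : B}
    (hc : Commute g h) : serre v N (x ⊗ₜ[k] g) (z ⊗ₜ[k] h) = serre v N x z ⊗ₜ[k] (g ^ N * h) := by
  have := congrArg (Algebra.TensorProduct.comm k B A) (serre_tmul_left v N x z hc)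
  rw [← AlgEquiv.coe_toAlgHom, map_serre] at this
  simpa using this

/-- The quantum Serre expression is additive under the commutation rules of the summands of
`Δ(x_i)` and `Δ(x_j)`. -/
theorem serre_add {v w : k} (h : Generic v) {N : ℕ} (hw : w * v ^ N = v) {P Q R W : A}
    (hQP : Q * P = v ^ 2 • (P * Q)) (hQR : Q * R = w • (R * Q)) (hWP : W * P = w • (P * W)) :
    serre v N (P + Q) (R + W) = serre v N P R + serre v N Q W := by
  have hv := h.ne_zero
  have hw0 : w ≠ 0 := by rintro rfl; simp [eq_comm, hv] at hw
  have h1 (n : ℕ) : Q * iter (v ^ 2) w P R n = (w * (v ^ 2) ^ n) • (iter (v ^ 2) w P R n * Q) := by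
    induction n with
    | zero => simpa [iter] using hQR
    | succ n ih =>
      rw [iter, mul_sub, ← mul_assoc, hQP, mul_smul_comm, ← mul_assoc Q, ih]
      simp only [smul_mul_assoc, mul_assoc, ih, hQP, mul_smul_comm, sub_mul, smul_sub, smul_smul]
      congr 1 <;> congr 1 <;> ring
  have h2 (n : ℕ) : iter (v ^ 2) w (P + Q) R n = iter (v ^ 2) w P R n := by
    induction n with
    | zero => rfl
    | succ n ih =>
      rw [iter, iter, ih, add_mul, mul_add, h1, smul_add]
      abel
  have h3 (n : ℕ) : iter (v⁻¹ ^ 2) w⁻¹ Q W n * P =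
      (w * (v ^ 2) ^ n) • (P * iter (v⁻¹ ^ 2) w⁻¹ Q W n) := by
    induction n with
    | zero => simpa [iter] using hWP
    | succ n ih =>
      rw [iter, sub_mul, mul_assoc, ih, mul_sub, smul_mul_assoc, mul_assoc _ Q P, hQP]
      simp only [smul_mul_assoc, mul_smul_comm, smul_sub, smul_smul, ← mul_assoc, ih, hQP]
      congr 1 <;> congr 1 <;> ring
  have h4 (n : ℕ) : iter (v⁻¹ ^ 2) w⁻¹ (P + Q) W n = iter (v⁻¹ ^ 2) w⁻¹ Q W n := by
    induction n with
    | zero => rfl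
    | succ n ih =>
      have : w⁻¹ * (v⁻¹ ^ 2) ^ n * (w * (v ^ 2) ^ n) = 1 := by
        simp only [inv_pow]
        field_simp
      rw [iter, iter, ih, add_mul, mul_add, h3, smul_add, smul_smul, this, one_smul]
      abel
  have hw' : w⁻¹ * v⁻¹ ^ N = v⁻¹ := by rw [inv_pow, ← mul_inv, hw]
  rw [serre_add_right]
  congr 1
  · rw [serre_eq_iter h _ _ _ hw, serre_eq_iter h _ _ _ hw, h2]
  · rw [← serre_inv, ← serre_inv v N Q, serre_eq_iter h.inv _ _ _ hw', serre_eq_iter h.inv _ _ _ hw', h4]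

theorem serre_twist {v w : k} (h : Generic v) {N : ℕ} (hw : w * v ^ N = v) {x z g f : A}
    (hgf : Commute g f) (hxg : x * g = v ^ 2 • (g * x)) (hzg : z * g = w • (g * z))
    (hxf : x * f = w • (f * x)) :
    ∃ c : k, serre v N (g * x) (f * z) = c • (g ^ N * f * serre v N x z) := by
  rw [serre_eq_iter h _ _ _ hw, serre_eq_iter h _ _ _ hw]
  have h1 (n : ℕ) : iter (v ^ 2) w x z n * g = (w * (v ^ 2) ^ n) • (g * iter (v ^ 2) w x z n) := by
    induction n with
    | zero => simpa [iter] using hzg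
    | succ n ih =>
      rw [iter, sub_mul, mul_assoc, ih, mul_sub, smul_mul_assoc, mul_assoc _ x g, hxg]
      simp only [smul_mul_assoc, mul_smul_comm, smul_sub, smul_smul, ← mul_assoc, ih, hxg]
      congr 1 <;> congr 1 <;> ring
  have h2 (n : ℕ) : x * (g ^ n * f) = (w * (v ^ 2) ^ n) • (g ^ n * f * x) := by
    induction n with
    | zero => simpa using hxf
    | succ n ih =>
      rw [pow_succ', mul_assoc, ← mul_assoc x, hxg, smul_mul_assoc, mul_assoc, ih]
      simp only [mul_smul_comm, smul_smul, ← mul_assoc]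
      congr 1; ring
  have h3 (n : ℕ) : ∃ c : k, iter (v ^ 2) w (g * x) (f * z) n =
      c • (g ^ n * f * iter (v ^ 2) w x z n) := by
    induction n with
    | zero => exact ⟨1, by simp [iter]⟩
    | succ n ih =>
      obtain ⟨c, hc⟩ := ih
      refine ⟨c * (w * (v ^ 2) ^ n), ?_⟩
      have e1 : g * x * (g ^ n * f * iter (v ^ 2) w x z n) =
          (w * (v ^ 2) ^ n) • (g ^ (n + 1) * f * (x * iter (v ^ 2) w x z n)) := by
        rw [mul_assoc g, ← mul_assoc x, h2]
        simp only [smul_mul_assoc, mul_smul_comm, pow_succ', mul_assoc]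
      have e2 : g ^ n * f * iter (v ^ 2) w x z n * (g * x) =
          (w * (v ^ 2) ^ n) • (g ^ (n + 1) * f * (iter (v ^ 2) w x z n * x)) := by
        rw [← mul_assoc, mul_assoc _ _ g, h1]
        simp only [smul_mul_assoc, mul_smul_comm, pow_succ, mul_assoc]
        rw [← mul_assoc f g, ← hgf.eq, mul_assoc]
      rw [iter, hc, mul_smul_comm, e1, smul_mul_assoc, e2, iter, mul_sub, mul_smul_comm]
      simp only [smul_sub, smul_smul]
      congr 2; ring
  exact h3 N

end QuantumSerre

/-- The ground field `ℂ(q)`. -/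
abbrev Cq : Type := RatFunc ℂ

/-- The indeterminate `q`. -/
abbrev qvar : Cq := RatFunc.X

/-- The Cartan matrix `a_{ij} = 2(α_i, α_j)/(α_i, α_i)` of a complex semisimple Lie algebra with
simple roots indexed by `ι`, and the positive integers `d_i = (α_i, α_i)/2` for an invariant inner
product; such matrices are those with the properties below, the matrix of all
`(α_i, α_j) = d_i a_{ij}` being symmetric and positive definite. -/
structure CartanDatum (ι : Type*) [Fintype ι] where
  A : Matrix ι ι ℤ
  d : ι → ℕ
  A_diag : ∀ i, A i i = 2
  A_offdiag : ∀ i j, i ≠ j → A i j ≤ 0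
  d_pos : ∀ i, 0 < d i
  symm : ∀ i j, (d i : ℤ) * A i j = d j * A j i
  posDef : (Matrix.of fun i j => (d i : ℝ) * (A i j : ℝ)).PosDef

namespace CartanDatum

variable {ι : Type*} [Fintype ι] (C : CartanDatum ι)

/-- `(α_i, α_j)`. -/
def form (i j : ι) : ℤ := C.d i * C.A i j

/-- `q_i = q^{(α_i, α_i)/2}`. -/
def qi (i : ι) : Cq := qvar ^ C.d i

/-- The exponent `1 - a_{ij}` (nonnegative for `i ≠ j`). -/
def serreExp (i j : ι) : ℕ := (1 - C.A i j).toNat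

theorem form_symm (i j : ι) : C.form i j = C.form j i := C.symm i j

theorem qvar_ne : qvar ≠ 0 := RatFunc.X_ne_zero

theorem qi_sq (i : ι) : C.qi i ^ 2 = qvar ^ C.form i i := by
  rw [qi, form, C.A_diag, ← pow_mul, ← zpow_natCast]
  push_cast
  rfl

theorem qi_serreExp {i j : ι} (h : i ≠ j) :
    qvar ^ C.form i j * C.qi i ^ C.serreExp i j = C.qi i := by
  have h1 := C.A_offdiag i j h
  have h2 : ((C.serreExp i j : ℕ) : ℤ) = 1 - C.A i j := Int.toNat_of_nonneg (by omega)
  rw [qi, form, ← pow_mul, ← zpow_natCast, ← zpow_natCast qvar (C.d i), ← zpow_add₀ qvar_ne]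
  congr 1
  push_cast
  rw [h2]
  ring

theorem qvar_pow_ne_one {n : ℕ} (hn : n ≠ 0) : qvar ^ n ≠ 1 := by
  intro h
  have h1 : (algebraMap (Polynomial ℂ) Cq) (Polynomial.X ^ n) = algebraMap _ _ 1 := by
    rw [map_pow, RatFunc.algebraMap_X, h, map_one]
  have h2 := RatFunc.algebraMap_injective ℂ h1
  have h3 := congrArg Polynomial.natDegree h2
  simp [hn] at h3

theorem generic (i : ι) : QuantumSerre.Generic (C.qi i) := by
  have h0 : C.qi i ≠ 0 := pow_ne_zero _ qvar_ne
  have h1 (n : ℕ) : C.qi i ^ (n + 1) - (C.qi i ^ (n + 1))⁻¹ ≠ 0 := by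
    intro h
    have h2 : C.qi i ^ (n + 1) * C.qi i ^ (n + 1) = 1 := by
      nth_rewrite 2 [sub_eq_zero.1 h]
      exact mul_inv_cancel₀ (pow_ne_zero _ h0)
    rw [qi, ← pow_mul, ← pow_add] at h2
    refine qvar_pow_ne_one ?_ h2
    have := (Nat.mul_pos (C.d_pos i) n.succ_pos).ne'
    simpa using this
  refine ⟨h0, fun n => div_ne_zero (h1 n) ?_⟩
  simpa using h1 0

/-- Elements `x_i, y_i, t_i, s_i = t_i⁻¹` of an algebra that satisfy the defining relations of
`U_q(g)`. -/
structure Relations {B : Type*} [Ring B] [Algebra Cq B] (x y t s : ι → B) : Prop where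
  t_s : ∀ i, t i * s i = 1
  s_t : ∀ i, s i * t i = 1
  t_t : ∀ i j, t i * t j = t j * t i
  t_x : ∀ i j, t i * x j = qvar ^ C.form i j • (x j * t i)
  t_y : ∀ i j, t i * y j = qvar ^ (-C.form i j) • (y j * t i)
  x_y : ∀ i j, i ≠ j → x i * y j - y j * x i = 0
  x_y_self : ∀ i, x i * y i - y i * x i = (C.qi i - (C.qi i)⁻¹)⁻¹ • (t i - s i)
  serre_x : ∀ i j, i ≠ j → QuantumSerre.serre (C.qi i) (C.serreExp i j) (x i) (x j) = 0
  serre_y : ∀ i j, i ≠ j → QuantumSerre.serre (C.qi i) (C.serreExp i j) (y i) (y j) = 0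

/-- The generators of `U_q(g)`; `s i` stands for `t_i⁻¹`. -/
inductive Gen (ι : Type*) where
  | x (i : ι) : Gen ι
  | y (i : ι) : Gen ι
  | t (i : ι) : Gen ι
  | s (i : ι) : Gen ι

/-- The free algebra on the generators. -/
abbrev Free (ι : Type*) := FreeAlgebra Cq (Gen ι)

/-- A generator, as an element of the free algebra. -/
def gen {ι : Type*} (g : Gen ι) : Free ι := FreeAlgebra.ι Cq g

open QuantumSerre in
/-- The defining relations of `U_q(g)`. -/
inductive Rel : Free ι → Free ι → Prop
  | t_s (i) : Rel (gen (.t i) * gen (.s i)) 1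
  | s_t (i) : Rel (gen (.s i) * gen (.t i)) 1
  | t_t (i j) : Rel (gen (.t i) * gen (.t j)) (gen (.t j) * gen (.t i))
  | t_x (i j) : Rel (gen (.t i) * gen (.x j)) (qvar ^ C.form i j • (gen (.x j) * gen (.t i)))
  | t_y (i j) : Rel (gen (.t i) * gen (.y j)) (qvar ^ (-C.form i j) • (gen (.y j) * gen (.t i)))
  | x_y (i j) (h : i ≠ j) : Rel (gen (.x i) * gen (.y j) - gen (.y j) * gen (.x i)) 0
  | x_y_self (i) : Rel (gen (.x i) * gen (.y i) - gen (.y i) * gen (.x i))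
      ((C.qi i - (C.qi i)⁻¹)⁻¹ • (gen (.t i) - gen (.s i)))
  | serre_x (i j) (h : i ≠ j) : Rel (serre (C.qi i) (C.serreExp i j) (gen (.x i)) (gen (.x j))) 0
  | serre_y (i j) (h : i ≠ j) : Rel (serre (C.qi i) (C.serreExp i j) (gen (.y i)) (gen (.y j))) 0

/-- The quantized enveloping algebra `U = U_q(g)`. -/
def Uq : Type _ := RingQuot C.Rel

namespace Uq

instance : Ring C.Uq := inferInstanceAs (Ring (RingQuot C.Rel))
instance : Algebra Cq C.Uq := inferInstanceAs (Algebra Cq (RingQuot C.Rel))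

/-- The quotient map. -/
def mk : Free ι →ₐ[Cq] C.Uq := RingQuot.mkAlgHom Cq C.Rel

theorem mk_rel {a b : Free ι} (h : C.Rel a b) : mk C a = mk C b := RingQuot.mkAlgHom_rel Cq h

theorem mk_surjective : Function.Surjective (mk C) := RingQuot.mkAlgHom_surjective Cq C.Rel

/-- The generator `x_i`. -/
def x (i : ι) : C.Uq := mk C (gen (.x i))
/-- The generator `y_i`. -/
def y (i : ι) : C.Uq := mk C (gen (.y i))
/-- The generator `t_i`. -/
def t (i : ι) : C.Uq := mk C (gen (.t i))
/-- The generator `t_i⁻¹`. -/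
def s (i : ι) : C.Uq := mk C (gen (.s i))

theorem relations : C.Relations (x C) (y C) (t C) (s C) where
  t_s i := by simpa using! mk_rel C (.t_s i)
  s_t i := by simpa using! mk_rel C (.s_t i)
  t_t i j := by simpa using! mk_rel C (.t_t i j)
  t_x i j := by simpa using! mk_rel C (.t_x i j)
  t_y i j := by simpa using! mk_rel C (.t_y i j)
  x_y i j h := by simpa using! mk_rel C (.x_y i j h)
  x_y_self i := by simpa using! mk_rel C (.x_y_self i)
  serre_x i j h := by simpa [QuantumSerre.map_serre] using! mk_rel C (.serre_x i j h)
  serre_y i j h := by simpa [QuantumSerre.map_serre] using! mk_rel C (.serre_y i j h)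

variable {C} {B : Type*} [Ring B] [Algebra Cq B] {x' y' t' s' : ι → B}

/-- The value of a map on generators. -/
def genMap (x' y' t' s' : ι → B) : Gen ι → B
  | .x i => x' i
  | .y i => y' i
  | .t i => t' i
  | .s i => s' i

/-- The universal property of `U_q(g)`. -/
def lift (h : C.Relations x' y' t' s') : C.Uq →ₐ[Cq] B :=
  RingQuot.liftAlgHom Cq ⟨FreeAlgebra.lift Cq (genMap x' y' t' s'), by
    intro a b hab
    cases hab with
    | t_s i => simpa [gen, genMap] using h.t_s i
    | s_t i => simpa [gen, genMap] using h.s_t i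
    | t_t i j => simpa [gen, genMap] using h.t_t i j
    | t_x i j => simpa [gen, genMap] using h.t_x i j
    | t_y i j => simpa [gen, genMap] using h.t_y i j
    | x_y i j hij => simpa [gen, genMap] using h.x_y i j hij
    | x_y_self i => simpa [gen, genMap] using h.x_y_self i
    | serre_x i j hij => simpa [gen, genMap, QuantumSerre.map_serre] using h.serre_x i j hij
    | serre_y i j hij => simpa [gen, genMap, QuantumSerre.map_serre] using h.serre_y i j hij⟩

theorem lift_mk (h : C.Relations x' y' t' s') (a : Free ι) :
    lift h (mk C a) = FreeAlgebra.lift Cq (genMap x' y' t' s') a :=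
  RingQuot.liftAlgHom_mkAlgHom_apply Cq _ _ _

@[simp] theorem lift_x (h : C.Relations x' y' t' s') (i : ι) : lift h (x C i) = x' i := by
  simp [x, lift_mk, gen, genMap]
@[simp] theorem lift_y (h : C.Relations x' y' t' s') (i : ι) : lift h (y C i) = y' i := by
  simp [y, lift_mk, gen, genMap]
@[simp] theorem lift_t (h : C.Relations x' y' t' s') (i : ι) : lift h (t C i) = t' i := by
  simp [t, lift_mk, gen, genMap]
@[simp] theorem lift_s (h : C.Relations x' y' t' s') (i : ι) : lift h (s C i) = s' i := by
  simp [s, lift_mk, gen, genMap]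

theorem induct {p : C.Uq → Prop} (hr : ∀ r, p (algebraMap Cq C.Uq r)) (hx : ∀ i, p (x C i))
    (hy : ∀ i, p (y C i)) (ht : ∀ i, p (t C i)) (hs : ∀ i, p (s C i))
    (hm : ∀ a b, p a → p b → p (a * b)) (ha : ∀ a b, p a → p b → p (a + b)) (a : C.Uq) : p a := by
  obtain ⟨a, rfl⟩ := mk_surjective C a
  induction a using FreeAlgebra.induction with
  | grade0 r => rw [AlgHom.commutes]; exact hr r
  | grade1 g =>
    cases g with
    | x i => exact hx i
    | y i => exact hy i
    | t i => exact ht i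
    | s i => exact hs i
  | mul a b h1 h2 => rw [map_mul]; exact hm _ _ h1 h2
  | add a b h1 h2 => rw [map_add]; exact ha _ _ h1 h2

theorem hom_ext {f g : C.Uq →ₐ[Cq] B} (hx : ∀ i, f (x C i) = g (x C i))
    (hy : ∀ i, f (y C i) = g (y C i)) (ht : ∀ i, f (t C i) = g (t C i))
    (hs : ∀ i, f (s C i) = g (s C i)) : f = g :=
  AlgHom.ext fun a => induct (p := fun a => f a = g a) (by simp) hx hy ht hs
    (fun a b h1 h2 => by simp [h1, h2]) (fun a b h1 h2 => by simp [h1, h2]) a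


theorem x_s (h : C.Relations x' y' t' s') (i j : ι) : x' j * s' i = qvar ^ C.form i j • (s' i * x' j) := by
  have h1 : s' i * (t' i * x' j) * s' i = s' i * (qvar ^ C.form i j • (x' j * t' i)) * s' i := by
    rw [h.t_x]
  rw [← mul_assoc, h.s_t, one_mul, mul_smul_comm, smul_mul_assoc, mul_assoc, mul_assoc, h.t_s,
    mul_one] at h1
  exact h1

theorem y_s (h : C.Relations x' y' t' s') (i j : ι) : y' j * s' i = qvar ^ (-C.form i j) • (s' i * y' j) := by
  have h1 : s' i * (t' i * y' j) * s' i = s' i * (qvar ^ (-C.form i j) • (y' j * t' i)) * s' i := by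
    rw [h.t_y]
  rw [← mul_assoc, h.s_t, one_mul, mul_smul_comm, smul_mul_assoc, mul_assoc, mul_assoc, h.t_s,
    mul_one] at h1
  exact h1

theorem y_t (h : C.Relations x' y' t' s') (i j : ι) : y' j * t' i = qvar ^ C.form i j • (t' i * y' j) := by
  rw [h.t_y, smul_smul, ← zpow_add₀ qvar_ne, add_neg_cancel, zpow_zero, one_smul]

theorem x_t (h : C.Relations x' y' t' s') (i j : ι) : x' j * t' i = qvar ^ (-C.form i j) • (t' i * x' j) := by
  rw [h.t_x, smul_smul, ← zpow_add₀ qvar_ne, neg_add_cancel, zpow_zero, one_smul]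

theorem s_y (h : C.Relations x' y' t' s') (i j : ι) : s' i * y' j = qvar ^ C.form i j • (y' j * s' i) := by
  rw [y_s h, smul_smul, ← zpow_add₀ qvar_ne, add_neg_cancel, zpow_zero, one_smul]

theorem s_t_comm (h : C.Relations x' y' t' s') (i j : ι) : s' i * t' j = t' j * s' i := by
  have h1 : s' i * (t' i * t' j) * s' i = s' i * (t' j * t' i) * s' i := by rw [h.t_t]
  rw [← mul_assoc, h.s_t, one_mul, mul_assoc, mul_assoc, h.t_s, mul_one] at h1
  exact h1.symm

theorem s_s (h : C.Relations x' y' t' s') (i j : ι) : s' i * s' j = s' j * s' i := by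
  have h1 : s' j * (s' i * t' j) * s' j = s' j * (t' j * s' i) * s' j := by rw [s_t_comm h]
  rw [← mul_assoc (s' j) (t' j), h.s_t, one_mul, mul_assoc, mul_assoc, h.t_s, mul_one] at h1
  exact h1.symm

variable (C)

theorem counit_relations :
    C.Relations (B := Cq) (fun _ => 0) (fun _ => 0) (fun _ => 1) (fun _ => 1) where
  t_s i := by simp
  s_t i := by simp
  t_t i j := by simp
  t_x i j := by simp
  t_y i j := by simp
  x_y i j h := by simp
  x_y_self i := by simp
  serre_x i j h := QuantumSerre.serre_zero_right _ _ _
  serre_y i j h := QuantumSerre.serre_zero_right _ _ _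

theorem scale_relations (c : ι → Cq) (hc : ∀ i, c i ≠ 0) :
    C.Relations (fun i => c i • x C i) (fun i => (c i)⁻¹ • y C i) (t C) (s C) where
  t_s i := (relations C).t_s i
  s_t i := (relations C).s_t i
  t_t i j := (relations C).t_t i j
  t_x i j := by
    rw [mul_smul_comm, (relations C).t_x, smul_mul_assoc, smul_comm]
  t_y i j := by
    rw [mul_smul_comm, (relations C).t_y, smul_mul_assoc, smul_comm]
  x_y i j h := by
    simp only [smul_mul_smul_comm]
    rw [mul_comm, ← smul_sub, (relations C).x_y i j h, smul_zero]
  x_y_self i := by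
    simp only [smul_mul_smul_comm]
    rw [inv_mul_cancel₀ (hc i), mul_inv_cancel₀ (hc i), one_smul, one_smul,
      (relations C).x_y_self i]
  serre_x i j h := by
    rw [QuantumSerre.serre_smul, (relations C).serre_x i j h, smul_zero]
  serre_y i j h := by
    rw [QuantumSerre.serre_smul, (relations C).serre_y i j h, smul_zero]

theorem comul_relations :
    C.Relations (B := C.Uq ⊗[Cq] C.Uq) (fun i => x C i ⊗ₜ 1 + t C i ⊗ₜ x C i)
      (fun i => y C i ⊗ₜ s C i + 1 ⊗ₜ y C i) (fun i => t C i ⊗ₜ t C i)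
      (fun i => s C i ⊗ₜ s C i) := by
  have R := relations C
  have hxy (i j : ι) : (x C i ⊗ₜ[Cq] (1 : C.Uq) + t C i ⊗ₜ x C i) * (y C j ⊗ₜ s C j + 1 ⊗ₜ y C j) -
      (y C j ⊗ₜ s C j + 1 ⊗ₜ y C j) * (x C i ⊗ₜ[Cq] (1 : C.Uq) + t C i ⊗ₜ x C i) =
      (x C i * y C j - y C j * x C i) ⊗ₜ s C j + t C i ⊗ₜ (x C i * y C j - y C j * x C i) := by
    have e : (t C i * y C j) ⊗ₜ[Cq] (x C i * s C j) = (y C j * t C i) ⊗ₜ (s C j * x C i) := by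
      rw [R.t_y, x_s R, C.form_symm j i, TensorProduct.smul_tmul_smul, ← zpow_add₀ qvar_ne,
        neg_add_cancel, zpow_zero, one_smul]
    simp only [mul_add, add_mul, Algebra.TensorProduct.tmul_mul_tmul, mul_one, one_mul, e,
      TensorProduct.sub_tmul, TensorProduct.tmul_sub]
    abel
  constructor
  · intro i; simp [R.t_s, Algebra.TensorProduct.one_def]
  · intro i; simp [R.s_t, Algebra.TensorProduct.one_def]
  · intro i j; simp [R.t_t i j]
  · intro i j
    simp only [mul_add, add_mul, Algebra.TensorProduct.tmul_mul_tmul, mul_one, one_mul, R.t_x,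
      R.t_t i j, smul_add, TensorProduct.tmul_smul, TensorProduct.smul_tmul']
  · intro i j
    simp only [mul_add, add_mul, Algebra.TensorProduct.tmul_mul_tmul, mul_one, one_mul, R.t_y,
      s_t_comm R j i, smul_add, TensorProduct.tmul_smul, TensorProduct.smul_tmul']
  · intro i j hij
    rw [hxy, R.x_y i j hij]
    simp
  · intro i
    rw [hxy, R.x_y_self]
    rw [← TensorProduct.smul_tmul', TensorProduct.tmul_smul, ← smul_add,
      TensorProduct.sub_tmul, TensorProduct.tmul_sub]
    congr 1
    abel
  · intro i j hij
    rw [QuantumSerre.serre_add (C.generic i) (C.qi_serreExp hij),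
      QuantumSerre.serre_tmul_right _ _ _ _ (Commute.one_left _), R.serre_x i j hij,
      QuantumSerre.serre_tmul_left _ _ _ _ (R.t_t i j), R.serre_x i j hij]
    · simp
    · simp [C.qi_sq, R.t_x, TensorProduct.smul_tmul']
    · simp [R.t_x, TensorProduct.smul_tmul']
    · simp [R.t_x, TensorProduct.smul_tmul', C.form_symm i j]
  · intro i j hij
    rw [add_comm (y C i ⊗ₜ[Cq] s C i), add_comm (y C j ⊗ₜ[Cq] s C j),
      QuantumSerre.serre_add (C.generic i) (C.qi_serreExp hij),
      QuantumSerre.serre_tmul_left _ _ _ _ (Commute.one_left _), R.serre_y i j hij,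
      QuantumSerre.serre_tmul_right _ _ _ _ (s_s R i j), R.serre_y i j hij]
    · simp
    · simp [C.qi_sq, s_y R]
    · simp [s_y R]
    · simp [s_y R, C.form_symm i j]

theorem antipode_relations :
    C.Relations (B := C.Uqᵐᵒᵖ) (fun i => .op (-(s C i * x C i))) (fun i => .op (-(y C i * t C i)))
      (fun i => .op (s C i)) (fun i => .op (t C i)) := by
  have R := relations C
  have hxy (i j : ι) : y C j * t C j * (s C i * x C i) = s C i * (y C j * x C i) * t C j := by
    have e1 : y C j * t C j * (s C i * x C i) = (y C j * s C i) * (t C j * x C i) := by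
      rw [mul_assoc, ← mul_assoc (t C j), ← s_t_comm R i j]
      simp only [mul_assoc]
    rw [e1, y_s R, R.t_x, smul_mul_smul_comm, C.form_symm j i, ← zpow_add₀ qvar_ne, neg_add_cancel,
      zpow_zero, one_smul]
    simp only [mul_assoc]
  have hxy' (i j : ι) : MulOpposite.op (-(s C i * x C i)) * MulOpposite.op (-(y C j * t C j)) -
      MulOpposite.op (-(y C j * t C j)) * MulOpposite.op (-(s C i * x C i)) =
      MulOpposite.op (-(s C i * (x C i * y C j - y C j * x C i) * t C j)) := by
    rw [← MulOpposite.op_mul, ← MulOpposite.op_mul, ← MulOpposite.op_sub, neg_mul_neg, neg_mul_neg,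
      hxy]
    congr 1
    simp only [mul_sub, sub_mul, mul_assoc]
    abel
  constructor
  · intro i; rw [← MulOpposite.op_mul, R.t_s, MulOpposite.op_one]
  · intro i; rw [← MulOpposite.op_mul, R.s_t, MulOpposite.op_one]
  · intro i j; rw [← MulOpposite.op_mul, ← MulOpposite.op_mul, s_s R]
  · intro i j
    rw [← MulOpposite.op_mul, ← MulOpposite.op_mul, ← MulOpposite.op_smul]
    congr 1
    rw [neg_mul, mul_assoc, x_s R, mul_smul_comm, mul_neg, smul_neg, ← mul_assoc, ← mul_assoc,
      s_s R]
  · intro i j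
    rw [← MulOpposite.op_mul, ← MulOpposite.op_mul, ← MulOpposite.op_smul]
    congr 1
    rw [neg_mul, mul_assoc, ← s_t_comm R, ← mul_assoc, y_s R, smul_mul_assoc, mul_neg, smul_neg,
      mul_assoc]
  · intro i j hij
    rw [hxy', R.x_y i j hij]
    simp
  · intro i
    rw [hxy', R.x_y_self, ← MulOpposite.op_sub, ← MulOpposite.op_smul]
    congr 1
    rw [mul_smul_comm, smul_mul_assoc, ← smul_neg, mul_sub, sub_mul, mul_assoc, mul_assoc,
      R.s_t, mul_one, ← mul_assoc, R.s_t, one_mul, neg_sub]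
  · intro i j hij
    obtain ⟨c, hc⟩ := QuantumSerre.serre_twist (C.generic i) (C.qi_serreExp hij)
      (x := x C i) (z := x C j) (g := s C i) (f := s C j) (s_s R i j)
      (by rw [C.qi_sq, x_s R]) (x_s R i j) (by rw [x_s R, C.form_symm])
    have h2 := QuantumSerre.serre_smul (C.qi i) (-1) (-1) (C.serreExp i j) (s C i * x C i)
      (s C j * x C j)
    rw [hc, R.serre_x i j hij] at h2
    simp only [neg_smul, one_smul, mul_zero, smul_zero] at h2
    rw [QuantumSerre.serre_op, h2]
    simp
  · intro i j hij
    obtain ⟨c, hc⟩ := QuantumSerre.serre_twist (C.generic i) (C.qi_serreExp hij)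
      (x := y C i) (z := y C j) (g := t C i) (f := t C j) (R.t_t i j)
      (by rw [C.qi_sq, y_t R]) (y_t R i j) (by rw [y_t R, C.form_symm])
    have h2 := QuantumSerre.serre_smul (C.qi i) (-qvar ^ C.form i i) (-qvar ^ C.form j j)
      (C.serreExp i j) (t C i * y C i) (t C j * y C j)
    rw [hc, R.serre_y i j hij] at h2
    simp only [neg_smul, ← y_t R, mul_zero, smul_zero] at h2
    rw [QuantumSerre.serre_op, h2]
    simp

/-- The comultiplication: `Δ(t) = t ⊗ t`, `Δ(x_i) = x_i ⊗ 1 + t_i ⊗ x_i`,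
`Δ(y_i) = y_i ⊗ t_i⁻¹ + 1 ⊗ y_i`. -/
def comulHom : C.Uq →ₐ[Cq] C.Uq ⊗[Cq] C.Uq := lift (comul_relations C)

/-- The counit: `ε(t) = 1`, `ε(x_i) = ε(y_i) = 0`. -/
def counitHom : C.Uq →ₐ[Cq] Cq := lift (counit_relations C)

/-- The antipode, as an algebra map to the opposite algebra: `σ(t) = t⁻¹`, `σ(x_i) = -t_i⁻¹ x_i`,
`σ(y_i) = -y_i t_i`. -/
def antipodeHom : C.Uq →ₐ[Cq] C.Uqᵐᵒᵖ := lift (antipode_relations C)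

instance : Bialgebra Cq C.Uq :=
  Bialgebra.ofAlgHom (comulHom C) (counitHom C)
    (by
      apply hom_ext <;> intro i <;>
        simp [comulHom, Algebra.TensorProduct.one_def, TensorProduct.tmul_add,
          TensorProduct.add_tmul, add_assoc])
    (by
      apply hom_ext <;> intro i <;>
        simp [comulHom, counitHom])
    (by
      apply hom_ext <;> intro i <;>
        simp [comulHom, counitHom])

/-- The antipode as a linear map. -/
def antipodeLin : C.Uq →ₗ[Cq] C.Uq :=
  (MulOpposite.opLinearEquiv Cq).symm.toLinearMap ∘ₗ (antipodeHom C).toLinearMap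

theorem comul_eq (a : C.Uq) : Coalgebra.comul (R := Cq) a = comulHom C a := rfl

theorem counit_eq (a : C.Uq) : Coalgebra.counit (R := Cq) a = counitHom C a := rfl

theorem antipodeLin_mul (a b : C.Uq) :
    antipodeLin C (a * b) = antipodeLin C b * antipodeLin C a := by
  simp [antipodeLin]

theorem antipodeLin_algebraMap (r : Cq) :
    antipodeLin C (algebraMap Cq C.Uq r) = algebraMap Cq C.Uq r := by
  simp [antipodeLin]

@[simp] theorem antipodeLin_x (i : ι) : antipodeLin C (x C i) = -(s C i * x C i) := by
  simp [antipodeLin, antipodeHom]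
@[simp] theorem antipodeLin_y (i : ι) : antipodeLin C (y C i) = -(y C i * t C i) := by
  simp [antipodeLin, antipodeHom]
@[simp] theorem antipodeLin_t (i : ι) : antipodeLin C (t C i) = s C i := by
  simp [antipodeLin, antipodeHom]
@[simp] theorem antipodeLin_s (i : ι) : antipodeLin C (s C i) = t C i := by
  simp [antipodeLin, antipodeHom]
theorem antipodeLin_one : antipodeLin C 1 = 1 := by
  simp [antipodeLin]

theorem antipode_left (a : C.Uq) :
    LinearMap.mul' Cq C.Uq ((antipodeLin C).rTensor C.Uq (comulHom C a)) =
      algebraMap Cq C.Uq (counitHom C a) := by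
  have R := relations C
  induction a using induct with
  | hr r => simp [Algebra.TensorProduct.algebraMap_apply, antipodeLin_algebraMap]
  | hx i => simp [comulHom, counitHom]
  | hy i => simp [comulHom, counitHom, mul_assoc, R.t_s, antipodeLin_one]
  | ht i => simp [comulHom, counitHom, R.s_t]
  | hs i => simp [comulHom, counitHom, R.t_s]
  | ha a b h1 h2 => simp only [map_add, h1, h2]
  | hm a b h1 h2 =>
    have k1 (S : C.Uq ⊗[Cq] C.Uq) (u w : C.Uq) :
        LinearMap.mul' Cq C.Uq ((antipodeLin C).rTensor C.Uq (S * (u ⊗ₜ w))) =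
          antipodeLin C u * LinearMap.mul' Cq C.Uq ((antipodeLin C).rTensor C.Uq S) * w := by
      induction S with
      | zero => simp
      | tmul p q => simp [antipodeLin_mul, mul_assoc]
      | add S S' h h' => simp only [add_mul, map_add, mul_add, h, h']
    have k2 (T : C.Uq ⊗[Cq] C.Uq) :
        LinearMap.mul' Cq C.Uq ((antipodeLin C).rTensor C.Uq (comulHom C a * T)) =
          counitHom C a • LinearMap.mul' Cq C.Uq ((antipodeLin C).rTensor C.Uq T) := by
      induction T with
      | zero => simp
      | tmul p q => rw [k1, h1]; simp [Algebra.algebraMap_eq_smul_one]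
      | add S S' h h' => simp only [mul_add, map_add, smul_add, h, h']
    rw [map_mul, k2, h2, map_mul, map_mul, Algebra.smul_def]

theorem antipode_right (a : C.Uq) :
    LinearMap.mul' Cq C.Uq ((antipodeLin C).lTensor C.Uq (comulHom C a)) =
      algebraMap Cq C.Uq (counitHom C a) := by
  have R := relations C
  induction a using induct with
  | hr r => simp [Algebra.TensorProduct.algebraMap_apply, antipodeLin_one]
  | hx i => simp [comulHom, counitHom, antipodeLin_one, ← mul_assoc, R.t_s]
  | hy i => simp [comulHom, counitHom]
  | ht i => simp [comulHom, counitHom, R.t_s]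
  | hs i => simp [comulHom, counitHom, R.s_t]
  | ha a b h1 h2 => simp only [map_add, h1, h2]
  | hm a b h1 h2 =>
    have k1 (S : C.Uq ⊗[Cq] C.Uq) (u w : C.Uq) :
        LinearMap.mul' Cq C.Uq ((antipodeLin C).lTensor C.Uq ((u ⊗ₜ w) * S)) =
          u * LinearMap.mul' Cq C.Uq ((antipodeLin C).lTensor C.Uq S) * antipodeLin C w := by
      induction S with
      | zero => simp
      | tmul p q => simp [antipodeLin_mul, mul_assoc]
      | add S S' h h' => simp only [add_mul, map_add, mul_add, h, h']
    have k2 (T : C.Uq ⊗[Cq] C.Uq) :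
        LinearMap.mul' Cq C.Uq ((antipodeLin C).lTensor C.Uq (T * comulHom C b)) =
          counitHom C b • LinearMap.mul' Cq C.Uq ((antipodeLin C).lTensor C.Uq T) := by
      induction T with
      | zero => simp
      | tmul p q => rw [k1, h2]; simp [Algebra.algebraMap_eq_smul_one]
      | add S S' h h' => simp only [add_mul, map_add, smul_add, h, h']
    rw [map_mul, k2, h1, map_mul, map_mul, Algebra.smul_def, Algebra.commutes]

instance : HopfAlgebra Cq C.Uq where
  antipode := antipodeLin C
  mul_antipode_rTensor_comul := LinearMap.ext (antipode_left C)
  mul_antipode_lTensor_comul := LinearMap.ext (antipode_right C)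

theorem antipode_bijective :
    Function.Bijective (HopfAlgebra.antipode Cq (A := C.Uq)) := by
  change Function.Bijective (antipodeLin C)
  have R := relations C
  let c : ι → Cq := fun i => qvar ^ (-C.form i i)
  have hc : ∀ i, c i ≠ 0 := fun i => zpow_ne_zero _ qvar_ne
  let θ := lift (scale_relations C c hc)
  let θ' := lift (scale_relations C (fun i => (c i)⁻¹) fun i => inv_ne_zero (hc i))
  have h1 : θ.comp θ' = AlgHom.id Cq C.Uq := by
    apply hom_ext <;> intro i <;> simp [θ, θ', smul_smul, hc]
  have h2 : θ'.comp θ = AlgHom.id Cq C.Uq := by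
    apply hom_ext <;> intro i <;> simp [θ, θ', smul_smul, hc]
  have hS (a : C.Uq) : antipodeLin C (antipodeLin C a) = θ a := by
    induction a using induct with
    | hr r => simp [antipodeLin_algebraMap]
    | hx i =>
      simp only [antipodeLin_x, map_neg, antipodeLin_mul, antipodeLin_s, θ, lift_x, c]
      rw [neg_mul, neg_neg, mul_assoc, x_t R, mul_smul_comm, ← mul_assoc, R.s_t, one_mul]
    | hy i =>
      simp only [antipodeLin_y, map_neg, antipodeLin_mul, antipodeLin_t, θ, lift_y, c]
      rw [mul_neg, neg_neg, y_t R, mul_smul_comm, ← mul_assoc, R.s_t, one_mul, zpow_neg, inv_inv]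
    | ht i => simp [θ]
    | hs i => simp [θ]
    | ha a b h1 h2 => simp only [map_add, h1, h2]
    | hm a b h1 h2 => simp only [antipodeLin_mul, map_mul, h1, h2]
  constructor
  · intro a b hab
    have h3 : θ a = θ b := by rw [← hS, ← hS, hab]
    have h4 := congrArg θ' h3
    rwa [← AlgHom.comp_apply, ← AlgHom.comp_apply, h2] at h4
  · intro a
    refine ⟨antipodeLin C (θ' a), ?_⟩
    rw [hS, ← AlgHom.comp_apply, h1, AlgHom.id_apply]

/-- The Hopf algebra `Uᵒᵖ`, with antipode `σ⁻¹`. -/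
instance : HopfAlgebra Cq C.Uqᵐᵒᵖ := HopfAd.hopfAlgebraOp Cq (antipode_bijective C)

end Uq

open HopfAd

/-- The algebra `F(U ⊗ Uᵒᵖ)ψ(U)`: the subalgebra of `U ⊗ Uᵒᵖ` generated by the locally finite part
`F(U ⊗ Uᵒᵖ)` and `ψ(U)`. That it is the set of all sums of products `f * r`, with `f` in
`F(U ⊗ Uᵒᵖ)` and `r` in `ψ(U)`, is the first part of the theorem stated about it. -/
def locFinPsi : Subalgebra Cq (C.Uq ⊗[Cq] C.Uqᵐᵒᵖ) :=
  locallyFinite Cq (C.Uq ⊗[Cq] C.Uqᵐᵒᵖ) ⊔ (psi Cq C.Uq).range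

end CartanDatum

end

universe u v

/-! ### Commutation of ψ with the two tensor legs, for an arbitrary Hopf algebra. -/

namespace HopfAd

open WithConv Algebra.TensorProduct

variable (k : Type*) {H : Type*} [Field k] [Ring H] [HopfAlgebra k H]

/-! The proof identifies F(H ⊗ Hᵒᵖ)ψ(H) with a smash product of F(H)ᵒᵖ and H, for any Hopf algebra H
over a field with bijective antipode, and reads off its modules.

The map u ⊗ w ↦ (1 ⊗ w)ψ(u) from H ⊗ H to H ⊗ Hᵒᵖ is bijective, with inverse u ⊗ w ↦ Δ(u)(1 ⊗ w)
(`comulMul_psiMul`, `psiMul_comulMul`). Transporting ψ(c)(1 ⊗ b) through it gives the straightening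
rule ψ(c)(1 ⊗ b) = ∑ (1 ⊗ (ad c₍₂₎)b)ψ(c₍₁₎). Since F(H) is ad-stable, (1 ⊗ F(H))ψ(H) is therefore a
subalgebra, `smash`, and as a vector space it is H ⊗ F(H). It contains a ⊗ 1 for a in F(H), because
a ⊗ 1 = ∑ (1 ⊗ a₍₂₎)ψ(a₍₁₎) (`psiMul_comul`) and Δ(F(H)) ⊆ H ⊗ F(H).

Contracting with functionals on either leg shows F(H ⊗ K) ⊆ F(H) ⊗ F(K), and `ad_op` shows that
F(Hᵒᵖ) and F(H) have the same elements. Hence F(H ⊗ Hᵒᵖ) lies in `smash`. Conversely 1 ⊗ b is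
locally finite for b in F(H), so `smash` is exactly F(H ⊗ Hᵒᵖ)ψ(H).

By the description as H ⊗ F(H), a `smash`-module amounts to a right F(H)-action and an H-action
satisfying (ad a)(m · c) = ∑ (ad a₍₁₎)m · (ad a₍₂₎)c. This is the first compatibility axiom with b =
1 (`adj_mul_right`). The second axiom, ∑ ((ad a₍₁₎)m) · a₍₂₎ = a · m, says that the left action is
that of a ⊗ 1, so it is determined by the other two. In the other direction every axiom is an
identity in `smash`, with the full first axiom coming from `psi_mul_tmul_tmul`. -/

theorem comulAlgHom_eq_conv :
    toConv (Bialgebra.comulAlgHom k H).toLinearMap =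
      toConv (includeLeft (R := k) (S := k) (A := H) (B := H)).toLinearMap *
        toConv (includeRight (R := k) (A := H) (B := H)).toLinearMap := by
  ext a
  rw [(Coalgebra.Repr.arbitrary k a).convMul_apply]
  simp [← (Coalgebra.Repr.arbitrary k a).eq]

/-- Both sides, as functions of `a`, are convolution inverses of Δ: Δ ∘ σ on the left, and the
product of the inverses of the two leg embeddings, in reverse order, on the right. Used to compute
the adjoint action of Hᵒᵖ. -/
theorem comul_antipode {ι : Type*} {a : H} (r : Coalgebra.Repr k a ι) :
    Coalgebra.comul (HopfAlgebra.antipode k a) =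
      ∑ i ∈ r.index, HopfAlgebra.antipode k (r.right i) ⊗ₜ[k]
        HopfAlgebra.antipode k (r.left i) := by
  have h : toConv ((Bialgebra.comulAlgHom k H).toLinearMap ∘ₗ HopfAlgebra.antipode k) =
      toConv ((includeRight (R := k) (A := H) (B := H)).toLinearMap ∘ₗ HopfAlgebra.antipode k) *
      toConv ((includeLeft (R := k) (S := k) (A := H) (B := H)).toLinearMap ∘ₗ
        HopfAlgebra.antipode k) := by
    refine left_inv_eq_right_inv (conv_antipode_mul k _) ?_
    rw [comulAlgHom_eq_conv, mul_assoc, ← mul_assoc (toConv includeRight.toLinearMap),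
      conv_mul_antipode, one_mul, conv_mul_antipode]
  have h2 := congrArg (fun f => f.ofConv a) h
  dsimp only at h2
  rw [r.convMul_apply] at h2
  simpa using h2

/-- The linear map `u ⊗ w ↦ (1 ⊗ w) ψ(u)`. -/
noncomputable def psiMul : H ⊗[k] H →ₗ[k] H ⊗[k] Hᵐᵒᵖ :=
  TensorProduct.lift (LinearMap.mk₂ k (fun u w => (1 ⊗ₜ MulOpposite.op w) * psi k H u)
    (by intros; simp [mul_add]) (by intros; rw [map_smul, mul_smul_comm])
    (by intros; simp [TensorProduct.tmul_add, add_mul])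
    (by intros; rw [MulOpposite.op_smul, TensorProduct.tmul_smul, smul_mul_assoc]))

@[simp]
theorem psiMul_tmul (u w : H) :
    psiMul k (u ⊗ₜ w) = (1 ⊗ₜ MulOpposite.op w) * psi k H u := rfl

theorem psi_apply {ι : Type*} {a : H} (r : Coalgebra.Repr k a ι) :
    psi k H a = ∑ i ∈ r.index,
      r.left i ⊗ₜ[k] MulOpposite.op (HopfAlgebra.antipode k (r.right i)) := by
  simp [psi, ← r.eq]

/-- The linear map `u ⊗ w ↦ Δ(u) (1 ⊗ w)`, inverse to `psiMul`. -/
noncomputable def comulMul : H ⊗[k] Hᵐᵒᵖ →ₗ[k] H ⊗[k] H :=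
  TensorProduct.lift (LinearMap.mk₂ k
    (fun u w => Coalgebra.comul u * ((1 : H) ⊗ₜ MulOpposite.unop w))
    (by intros; simp [add_mul]) (by intros; simp)
    (by intros; simp [TensorProduct.tmul_add, mul_add])
    (by intros; simp [TensorProduct.tmul_smul]))

@[simp]
theorem comulMul_tmul (u : H) (w : Hᵐᵒᵖ) :
    comulMul k (u ⊗ₜ w) = Coalgebra.comul u * (1 ⊗ₜ MulOpposite.unop w) := rfl

theorem comulMul_mul (b : H) (e : H ⊗[k] Hᵐᵒᵖ) :
    comulMul k ((1 ⊗ₜ MulOpposite.op b) * e) = comulMul k e * (1 ⊗ₜ b) := by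
  induction e with
  | zero => simp
  | tmul x y => simp [mul_assoc]
  | add s t hs ht => simp only [mul_add, map_add, add_mul, hs, ht]

/-- Both sides are ∑ c₍₁₎ ⊗ c₍₂₎ b σ(c₍₃₎). This is the straightening rule for ψ(c)(1 ⊗ b), seen
through `comulMul`. -/
theorem comulMul_psi_mul (b c : H) :
    comulMul k (psi k H c * (1 ⊗ₜ MulOpposite.op b)) =
      ((ad k H).toLinearMap.flip b).lTensor H (Coalgebra.comul c) := by
  have h : (toConv (Bialgebra.comulAlgHom k H).toLinearMap * const k H ((1 : H) ⊗ₜ[k] b) *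
      toConv ((includeRight (R := k) (A := H) (B := H)).toLinearMap ∘ₗ
        HopfAlgebra.antipode k)).ofConv c =
      comulMul k (psi k H c * (1 ⊗ₜ MulOpposite.op b)) := by
    rw [(Coalgebra.Repr.arbitrary k c).convMul_apply, psi_apply k (Coalgebra.Repr.arbitrary k c)]
    simp only [mul_const, Finset.sum_mul, map_sum]
    simp [mul_assoc]
  -- With Δ written as the convolution product of the two leg embeddings, regrouping leaves the left
  -- leg as c₍₁₎ and assembles the remaining three factors into 1 ⊗ (ad c₍₂₎)b.
  rw [← h, comulAlgHom_eq_conv, mul_assoc, mul_assoc, (Coalgebra.Repr.arbitrary k c).convMul_apply,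
    ← (Coalgebra.Repr.arbitrary k c).eq, map_sum]
  refine Finset.sum_congr rfl fun i _ => ?_
  rw [← mul_assoc]
  rw [(Coalgebra.Repr.arbitrary k _).convMul_apply]
  simp only [mul_const]
  simp [ad_apply k (Coalgebra.Repr.arbitrary k _), TensorProduct.tmul_sum, Finset.mul_sum]

theorem flip_ad_one :
    (ad k H).toLinearMap.flip 1 = LinearMap.toSpanSingleton k H 1 ∘ₗ Coalgebra.counit := by
  ext a
  simp [ad_one, Algebra.algebraMap_eq_smul_one]

theorem comulMul_psi (c : H) : comulMul k (psi k H c) = c ⊗ₜ 1 := by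
  have h := comulMul_psi_mul k 1 c
  rw [MulOpposite.op_one, ← Algebra.TensorProduct.one_def, mul_one, flip_ad_one,
    LinearMap.lTensor_comp, LinearMap.comp_apply, Coalgebra.lTensor_counit_comul] at h
  simpa using h

theorem comulMul_psiMul (t : H ⊗[k] H) : comulMul k (psiMul k t) = t := by
  induction t with
  | zero => simp
  | tmul x y => simp [comulMul_mul, comulMul_psi]
  | add s t hs ht => simp only [map_add, hs, ht]

theorem psiMul_mul (b : H) (t : H ⊗[k] H) :
    psiMul k (t * (1 ⊗ₜ b)) = (1 ⊗ₜ MulOpposite.op b) * psiMul k t := by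
  induction t with
  | zero => simp
  | tmul x y => simp [← mul_assoc]
  | add s t hs ht => simp only [map_add, add_mul, mul_add, hs, ht]

/-- The left side is ∑ a₍₁₎ ⊗ σ(a₍₂₎)a₍₃₎, which collapses by the antipode and counit axioms. It is
the universal form of the axiom ∑ ((ad a₍₁₎)m) · a₍₂₎ = a · m. -/
theorem psiMul_comul (a : H) : psiMul k (Coalgebra.comul a) = a ⊗ₜ 1 := by
  let m : H ⊗[k] H →ₗ[k] Hᵐᵒᵖ := (MulOpposite.opLinearEquiv k).toLinearMap ∘ₗ
    LinearMap.mul' k H ∘ₗ (HopfAlgebra.antipode k).rTensor H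
  have h (t : H ⊗[k] H) : psiMul k t =
      m.lTensor H (TensorProduct.assoc k H H H (Coalgebra.comul.rTensor H t)) := by
    induction t with
    | zero => simp
    | tmul x y =>
      rw [psiMul_tmul, psi_apply k (Coalgebra.Repr.arbitrary k x), LinearMap.rTensor_tmul,
        ← (Coalgebra.Repr.arbitrary k x).eq, TensorProduct.sum_tmul, Finset.mul_sum, map_sum,
        map_sum]
      simp [m]
    | add s t hs ht => simp only [map_add, hs, ht]
  have hm : m ∘ₗ Coalgebra.comul = LinearMap.toSpanSingleton k Hᵐᵒᵖ 1 ∘ₗ Coalgebra.counit := by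
    ext c
    simp [m, Algebra.algebraMap_eq_smul_one]
  rw [h, Coalgebra.coassoc_apply, ← LinearMap.comp_apply, ← LinearMap.lTensor_comp, hm,
    LinearMap.lTensor_comp, LinearMap.comp_apply, Coalgebra.lTensor_counit_comul]
  simp

theorem psiMul_comulMul (e : H ⊗[k] Hᵐᵒᵖ) : psiMul k (comulMul k e) = e := by
  induction e with
  | zero => simp
  | tmul x y => simp [psiMul_mul, psiMul_comul]
  | add s t hs ht => simp only [map_add, hs, ht]

/-- `ψ(c) (1 ⊗ b) = ∑ (1 ⊗ (ad c₍₂₎) b) ψ(c₍₁₎)`. -/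
theorem psi_mul_tmul_right (b c : H) :
    psi k H c * (1 ⊗ₜ MulOpposite.op b) =
      psiMul k (((ad k H).toLinearMap.flip b).lTensor H (Coalgebra.comul c)) := by
  rw [← comulMul_psi_mul, psiMul_comulMul]

theorem psi_eq_conv :
    toConv (psi k H).toLinearMap =
      toConv (includeLeft (R := k) (S := k) (A := H) (B := Hᵐᵒᵖ)).toLinearMap *
        toConv ((includeRight (R := k) (A := H) (B := Hᵐᵒᵖ)).toLinearMap ∘ₗ
          (MulOpposite.opLinearEquiv k).toLinearMap ∘ₗ HopfAlgebra.antipode k) := by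
  ext a
  rw [(Coalgebra.Repr.arbitrary k a).convMul_apply]
  simp [psi_apply k (Coalgebra.Repr.arbitrary k a)]

/-- `ψ(c) (a ⊗ 1) = ∑ ((ad c₍₁₎) a ⊗ 1) ψ(c₍₂₎)`. -/
theorem psi_mul_tmul_left {ι : Type*} {c : H} (r : Coalgebra.Repr k c ι) (a : H) :
    psi k H c * (a ⊗ₜ 1) =
      ∑ i ∈ r.index, (ad k H (r.left i) a ⊗ₜ 1) * psi k H (r.right i) := by
  let i1 : H →ₐ[k] H ⊗[k] Hᵐᵒᵖ := includeLeft
  let j2 := toConv ((includeRight (R := k) (A := H) (B := Hᵐᵒᵖ)).toLinearMap ∘ₗ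
    (MulOpposite.opLinearEquiv k).toLinearMap ∘ₗ HopfAlgebra.antipode k (A := H))
  let f := const k H (a ⊗ₜ[k] (1 : Hᵐᵒᵖ))
  -- The values of `j2` lie in 1 ⊗ Hᵒᵖ and so commute with a ⊗ 1.
  have hj : j2 * f = f * j2 := by
    ext c
    change (j2 * f).ofConv c = (f * j2).ofConv c
    rw [mul_const, const_mul]
    simp [j2]
  -- On the right, the antipode factor cancels the left-leg factor of ψ; what remains differs from
  -- the left side only by the order of `f` and `j2`.
  have h : toConv (psi k H).toLinearMap * f =
      (toConv i1.toLinearMap * f * toConv (i1.toLinearMap ∘ₗ HopfAlgebra.antipode k)) *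
        toConv (psi k H).toLinearMap := by
    rw [psi_eq_conv, mul_assoc, hj, mul_assoc _ (toConv _) (_ * _),
      ← mul_assoc _ (toConv includeLeft.toLinearMap), conv_antipode_mul, one_mul]
    rw [mul_assoc]
  have h2 := congrArg (fun f => f.ofConv c) h
  rw [mul_const, r.convMul_apply] at h2
  refine h2.trans (Finset.sum_congr rfl fun i _ => ?_)
  congr 1
  rw [(Coalgebra.Repr.arbitrary k _).convMul_apply]
  simp only [i1, f, mul_const]
  simp [ad_apply k (Coalgebra.Repr.arbitrary k _), TensorProduct.sum_tmul]

end HopfAd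

/-! ### The locally finite part of a tensor product and of the opposite algebra. -/

namespace HopfAd

open Algebra.TensorProduct

section LocallyFinite

variable (k : Type*) {H : Type*} [Field k] [Ring H] [HopfAlgebra k H]
variable {K : Type*} [Ring K] [HopfAlgebra k K]

theorem ad_tmul_tmul (h v : H) (h' v' : K) :
    ad k (H ⊗[k] K) (h ⊗ₜ h') (v ⊗ₜ v') = ad k H h v ⊗ₜ ad k K h' v' := by
  let r := Coalgebra.Repr.arbitrary k h
  let r' := Coalgebra.Repr.arbitrary k h'
  let s : Coalgebra.Repr k (h ⊗ₜ[k] h') (_ × _) :=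
    { index := r.index ×ˢ r'.index
      left := fun i => r.left i.1 ⊗ₜ r'.left i.2
      right := fun i => r.right i.1 ⊗ₜ r'.right i.2
      eq := by
        rw [TensorProduct.comul_tmul, ← r.eq, ← r'.eq, Finset.sum_product_right]
        simp [TensorProduct.sum_tmul, TensorProduct.tmul_sum] }
  rw [ad_apply k s, ad_apply k r, ad_apply k r', Finset.sum_product_right]
  simp [s, TensorProduct.sum_tmul, TensorProduct.tmul_sum]

theorem ad_tmul_eq_map (h : H) (h' : K) :
    ad k (H ⊗[k] K) (h ⊗ₜ h') = TensorProduct.map (ad k H h) (ad k K h') :=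
  TensorProduct.ext' fun v v' => by simp [ad_tmul_tmul]

theorem tmul_mem_locallyFinite {a : H} {b : K} (ha : a ∈ locallyFinite k H)
    (hb : b ∈ locallyFinite k K) : a ⊗ₜ[k] b ∈ locallyFinite k (H ⊗[k] K) := by
  rw [mem_locallyFinite] at ha hb ⊢
  refine Submodule.finiteDimensional_of_le
    (S₂ := LinearMap.range (TensorProduct.map (adOrbit k a).subtype (adOrbit k b).subtype)) ?_
  rintro _ ⟨t, rfl⟩
  change ad k (H ⊗[k] K) t (a ⊗ₜ b) ∈ _
  induction t with
  | zero => simp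
  | tmul x y =>
    rw [ad_tmul_tmul]
    exact ⟨⟨_, ad_mem_adOrbit k x a⟩ ⊗ₜ ⟨_, ad_mem_adOrbit k y b⟩, rfl⟩
  | add s t hs ht => rw [map_add]; exact Submodule.add_mem _ hs ht

theorem lid_rTensor_comm {M N N' : Type*} [AddCommGroup M] [Module k M] [AddCommGroup N]
    [Module k N] [AddCommGroup N'] [Module k N'] (f : M →ₗ[k] k) (g : N →ₗ[k] N')
    (t : M ⊗[k] N) :
    TensorProduct.lid k N' (f.rTensor N' (g.lTensor M t)) =
      g (TensorProduct.lid k N (f.rTensor N t)) := by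
  induction t with
  | zero => simp
  | tmul x y => simp
  | add s t hs ht => simp only [map_add, hs, ht]

/-- In a basis of `M`, the coefficients of `t` are its contractions with the coordinate functionals.
-/
theorem mem_range_lTensor_of_contract {M N : Type*} [AddCommGroup M] [Module k M] [AddCommGroup N]
    [Module k N] (W : Submodule k N) (t : M ⊗[k] N)
    (h : ∀ f : M →ₗ[k] k, TensorProduct.lid k N (f.rTensor N t) ∈ W) :
    t ∈ LinearMap.range (W.subtype.lTensor M) := by
  classical
  let b := Module.Free.chooseBasis k M
  have ht : t = (TensorProduct.equivFinsuppOfBasisLeft b).symm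
    (TensorProduct.equivFinsuppOfBasisLeft b t) := by simp
  rw [ht, TensorProduct.equivFinsuppOfBasisLeft_symm_apply]
  refine Submodule.sum_mem _ fun i _ => ?_
  have hi : TensorProduct.equivFinsuppOfBasisLeft (N := N) b t i ∈ W := by
    convert h (b.coord i) using 1
    exact TensorProduct.equivFinsuppOfBasisLeft_apply _ _ _
  exact ⟨b i ⊗ₜ ⟨_, hi⟩, by simp⟩

/-- Contraction of the left leg intertwines ad(1 ⊗ a) with ad a, so it maps the finite-dimensional
orbit of `v` onto a space containing the orbit of the contraction. -/
theorem contract_mem_locallyFinite {v : H ⊗[k] K} (hv : v ∈ locallyFinite k (H ⊗[k] K))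
    (f : H →ₗ[k] k) : TensorProduct.lid k K (f.rTensor K v) ∈ locallyFinite k K := by
  rw [mem_locallyFinite] at hv ⊢
  refine Submodule.finiteDimensional_of_le
    (S₂ := (adOrbit k v).map ((TensorProduct.lid k K).toLinearMap ∘ₗ f.rTensor K)) ?_
  rintro _ ⟨a, rfl⟩
  refine ⟨_, ad_mem_adOrbit k (1 ⊗ₜ a) v, ?_⟩
  rw [ad_tmul_eq_map, map_one]
  exact lid_rTensor_comm k f (ad k K a) v

theorem contract_right_mem_locallyFinite {v : H ⊗[k] K} (hv : v ∈ locallyFinite k (H ⊗[k] K))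
    (f : K →ₗ[k] k) :
    TensorProduct.lid k H (f.rTensor H (TensorProduct.comm k H K v)) ∈ locallyFinite k H := by
  rw [mem_locallyFinite] at hv ⊢
  refine Submodule.finiteDimensional_of_le
    (S₂ := (adOrbit k v).map ((TensorProduct.lid k H).toLinearMap ∘ₗ f.rTensor H ∘ₗ
      (TensorProduct.comm k H K).toLinearMap)) ?_
  rintro _ ⟨a, rfl⟩
  refine ⟨_, ad_mem_adOrbit k (a ⊗ₜ 1) v, ?_⟩
  rw [ad_tmul_eq_map, map_one]
  change _ = ad k H a _
  rw [← lid_rTensor_comm k f (ad k H a)]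
  simp only [LinearMap.comp_apply, LinearEquiv.coe_coe]
  congr 2
  exact (TensorProduct.map_comm _ _ _).symm

theorem lTensor_comm {M N P : Type*} [AddCommGroup M] [Module k M] [AddCommGroup N]
    [Module k N] [AddCommGroup P] [Module k P] (g : M →ₗ[k] P) (t : N ⊗[k] M) :
    g.rTensor N (TensorProduct.comm k N M t) = TensorProduct.comm k N P (g.lTensor N t) := by
  induction t with
  | zero => simp
  | tmul x y => simp
  | add s t hs ht => simp only [map_add, hs, ht]

theorem mem_range_map_of_contract {M N : Type*} [AddCommGroup M] [Module k M] [AddCommGroup N]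
    [Module k N] (V : Submodule k M) (W : Submodule k N) (t : M ⊗[k] N)
    (hV : ∀ f : N →ₗ[k] k,
      TensorProduct.lid k M (f.rTensor M (TensorProduct.comm k M N t)) ∈ V)
    (hW : ∀ f : M →ₗ[k] k, TensorProduct.lid k N (f.rTensor N t) ∈ W) :
    t ∈ LinearMap.range (TensorProduct.map V.subtype W.subtype) := by
  obtain ⟨w, hw⟩ := mem_range_lTensor_of_contract k V (TensorProduct.comm k M N t) hV
  have hw' : t = V.subtype.rTensor N (TensorProduct.comm k _ _ w) := by
    rw [lTensor_comm, hw]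
    simp
  obtain ⟨z, hz⟩ := mem_range_lTensor_of_contract k W (TensorProduct.comm k _ _ w) (fun f => by
      -- The first application has already placed the left leg in `V`. A functional on `V` extends
      -- to `M`, so contracting the lifted tensor agrees with contracting `t`.
      obtain ⟨g, rfl⟩ := LinearMap.exists_extend f
      rw [LinearMap.rTensor_comp_apply, ← hw']
      exact hW g)
  refine ⟨z, ?_⟩
  rw [hw', ← hz, ← LinearMap.comp_apply, LinearMap.rTensor_comp_lTensor]

/-- `F(H ⊗ K) ⊆ F(H) ⊗ F(K)`. -/
theorem locallyFinite_tensorProduct {v : H ⊗[k] K} (hv : v ∈ locallyFinite k (H ⊗[k] K)) :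
    v ∈ LinearMap.range (TensorProduct.map (locallyFinite k H).toSubmodule.subtype
      (locallyFinite k K).toSubmodule.subtype) :=
  mem_range_map_of_contract k _ _ v (contract_right_mem_locallyFinite k hv)
    (contract_mem_locallyFinite k hv)

end LocallyFinite

section Op

variable (k : Type*) {H : Type*} [Field k] [Ring H] [HopfAlgebra k H]

/-- The antipode of Hᵒᵖ is σ⁻¹ and Δ(σ(c)) = ∑ σ(c₍₂₎) ⊗ σ(c₍₁₎), so the left side is the product of
σ(c₍₂₎), b and c₍₁₎ in Hᵒᵖ, which is c₍₁₎ b σ(c₍₂₎) in H. -/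
theorem ad_op (h : Function.Bijective (HopfAlgebra.antipode k (A := H))) (c b : H) :
    letI := hopfAlgebraOp k h
    ad k Hᵐᵒᵖ (MulOpposite.op (HopfAlgebra.antipode k c)) (MulOpposite.op b) =
      MulOpposite.op (ad k H c b) := by
  let := hopfAlgebraOp k h
  let r := Coalgebra.Repr.arbitrary k c
  let s : Coalgebra.Repr k (MulOpposite.op (HopfAlgebra.antipode k c)) _ :=
    { index := r.index
      left := fun i => MulOpposite.op (HopfAlgebra.antipode k (r.right i))
      right := fun i => MulOpposite.op (HopfAlgebra.antipode k (r.left i))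
      eq := by
        simp [MulOpposite.comul_def, comul_antipode k r] }
  have hS (x : H) : HopfAlgebra.antipode k (MulOpposite.op (HopfAlgebra.antipode k x)) =
      MulOpposite.op x :=
    congrArg MulOpposite.op ((LinearEquiv.ofBijective (HopfAlgebra.antipode k) h).symm_apply_apply x)
  rw [ad_apply k s, ad_apply k r]
  simp [s, hS, mul_assoc]

/-- `F(Hᵒᵖ) = F(H)`. -/
theorem op_mem_locallyFinite (h : Function.Bijective (HopfAlgebra.antipode k (A := H))) (b : H) :
    letI := hopfAlgebraOp k h
    MulOpposite.op b ∈ locallyFinite k Hᵐᵒᵖ ↔ b ∈ locallyFinite k H := by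
  let := hopfAlgebraOp k h
  have e : adOrbit k (MulOpposite.op b) =
      (adOrbit k b).map (MulOpposite.opLinearEquiv k).toLinearMap := by
    apply le_antisymm
    · rintro _ ⟨a, rfl⟩
      -- Surjectivity of σ makes every element of Hᵒᵖ of the form required by `ad_op`, so the two
      -- orbits coincide.
      obtain ⟨c, hc⟩ := h.2 (MulOpposite.unop a)
      refine ⟨_, ad_mem_adOrbit k c b, ?_⟩
      have := ad_op k h c b
      rw [hc] at this
      exact this.symm
    · rintro _ ⟨_, ⟨c, rfl⟩, rfl⟩
      exact ⟨_, ad_op k h c b⟩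
  rw [mem_locallyFinite, mem_locallyFinite, e]
  exact (Module.Finite.equiv_iff (LinearEquiv.submoduleMap (MulOpposite.opLinearEquiv k) _)).symm

end Op

end HopfAd

/-! ### The smash product subalgebra (1 ⊗ F(H))ψ(H). -/

namespace HopfAd

open Algebra.TensorProduct

variable (k : Type*) {H : Type*} [Field k] [Ring H] [HopfAlgebra k H]

/-- The axioms of `CompatibleBimodule` speak of expansions indexed by `Fin n`; this and the next
lemma supply such expansions. -/
theorem exists_fin_sum_tmul {M N : Type*} [AddCommGroup M] [Module k M] [AddCommGroup N]
    [Module k N] (t : M ⊗[k] N) :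
    ∃ (n : ℕ) (x : Fin n → M) (y : Fin n → N), ∑ i, x i ⊗ₜ[k] y i = t := by
  induction t with
  | zero => exact ⟨0, Fin.elim0, Fin.elim0, by simp⟩
  | tmul x y => exact ⟨1, fun _ => x, fun _ => y, by simp⟩
  | add s t hs ht =>
    obtain ⟨n, x, y, rfl⟩ := hs
    obtain ⟨n', x', y', rfl⟩ := ht
    exact ⟨n + n', Fin.append x x', Fin.append y y', by simp [Fin.sum_univ_add]⟩

theorem exists_fin_sum_tmul_tmul {M N P : Type*} [AddCommGroup M] [Module k M] [AddCommGroup N]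
    [Module k N] [AddCommGroup P] [Module k P] (t : M ⊗[k] (N ⊗[k] P)) :
    ∃ (n : ℕ) (x : Fin n → M) (y : Fin n → N) (z : Fin n → P),
      ∑ i, x i ⊗ₜ[k] (y i ⊗ₜ[k] z i) = t := by
  induction t with
  | zero => exact ⟨0, Fin.elim0, Fin.elim0, Fin.elim0, by simp⟩
  | tmul x s =>
    obtain ⟨n, y, z, rfl⟩ := exists_fin_sum_tmul k s
    exact ⟨n, fun _ => x, y, z, by simp [TensorProduct.tmul_sum]⟩
  | add s t hs ht =>
    obtain ⟨n, x, y, z, rfl⟩ := hs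
    obtain ⟨n', x', y', z', rfl⟩ := ht
    exact ⟨n + n', Fin.append x x', Fin.append y y', Fin.append z z', by
      simp [Fin.sum_univ_add]⟩

variable (H) in
/-- The linear map `u ⊗ b ↦ (1 ⊗ b) ψ(u)` on `H ⊗ F(H)`. -/
noncomputable def locFinPsiMul : H ⊗[k] locallyFinite k H →ₗ[k] H ⊗[k] Hᵐᵒᵖ :=
  psiMul k ∘ₗ (locallyFinite k H).val.toLinearMap.lTensor H

@[simp]
theorem locFinPsiMul_tmul (u : H) (b : locallyFinite k H) :
    locFinPsiMul k H (u ⊗ₜ b) = (1 ⊗ₜ MulOpposite.op (b : H)) * psi k H u := rfl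

/-- `psiMul` has a left inverse, and tensoring the inclusion of F(H) with H stays injective over a
field. This is what allows an action of the subalgebra to be defined on tensors. -/
theorem locFinPsiMul_injective : Function.Injective (locFinPsiMul k H) := by
  refine Function.Injective.comp (g := psiMul k)
    (Function.LeftInverse.injective (comulMul_psiMul k)) ?_
  exact Module.Flat.lTensor_preserves_injective_linearMap _ Subtype.val_injective

theorem psi_mul_tmul_right_eq_sum {ι : Type*} {c : H} (r : Coalgebra.Repr k c ι) (b : H) :
    psi k H c * (1 ⊗ₜ MulOpposite.op b) =
      ∑ i ∈ r.index, (1 ⊗ₜ MulOpposite.op (ad k H (r.right i) b)) * psi k H (r.left i) := by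
  simp [psi_mul_tmul_right, ← r.eq]

/-- The smash product multiplication: ψ(u) is moved past 1 ⊗ b' by the straightening rule. The
factor `b` ends up on the right because the second leg is multiplied in Hᵒᵖ. -/
theorem locFinPsiMul_mul {ι : Type*} {u : H} (r : Coalgebra.Repr k u ι) (u' : H)
    (b b' : locallyFinite k H) :
    locFinPsiMul k H (u ⊗ₜ b) * locFinPsiMul k H (u' ⊗ₜ b') =
      locFinPsiMul k H
        (∑ i ∈ r.index, (r.left i * u') ⊗ₜ (adF k H (r.right i) b' * b)) := by
  rw [locFinPsiMul_tmul, locFinPsiMul_tmul, mul_assoc, ← mul_assoc (psi k H u),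
    psi_mul_tmul_right_eq_sum k r, Finset.sum_mul, Finset.mul_sum, map_sum]
  refine Finset.sum_congr rfl fun i _ => ?_
  simp only [locFinPsiMul_tmul, map_mul, ← mul_assoc, tmul_mul_tmul, one_mul,
    ← MulOpposite.op_mul]
  rfl

variable (H) in
/-- The subalgebra `(1 ⊗ F(H)) ψ(H)` of `H ⊗ Hᵒᵖ`. -/
noncomputable def smash : Subalgebra k (H ⊗[k] Hᵐᵒᵖ) :=
  (LinearMap.range (locFinPsiMul k H)).toSubalgebra
    ⟨1 ⊗ₜ 1, by simp [Algebra.TensorProduct.one_def]⟩ (by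
      rintro _ _ ⟨s, rfl⟩ ⟨t, rfl⟩
      induction s with
      | zero => simp
      | add s s' hs hs' => rw [map_add, add_mul]; exact Submodule.add_mem _ hs hs'
      | tmul u b =>
        induction t with
        | zero => simp
        | add s s' hs hs' => rw [map_add, mul_add]; exact Submodule.add_mem _ hs hs'
        | tmul u' b' => exact ⟨_, (locFinPsiMul_mul k (Coalgebra.Repr.arbitrary k u) _ _ _).symm⟩)

/-- A lift of `Δ(a)` to `H ⊗ F(H)`. -/
theorem exists_lTensor_eq_comul (a : locallyFinite k H) :
    ∃ t : H ⊗[k] locallyFinite k H,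
      (locallyFinite k H).val.toLinearMap.lTensor H t = Coalgebra.comul (a : H) :=
  comul_mem_range k a.2

theorem locFinPsiMul_of_lTensor_eq_comul {a : H} {t : H ⊗[k] locallyFinite k H}
    (h : (locallyFinite k H).val.toLinearMap.lTensor H t = Coalgebra.comul a) :
    locFinPsiMul k H t = a ⊗ₜ 1 := by
  rw [locFinPsiMul, LinearMap.comp_apply, h, psiMul_comul]

theorem psi_mem_smash (c : H) : psi k H c ∈ smash k H :=
  ⟨c ⊗ₜ 1, by simp [← Algebra.TensorProduct.one_def]⟩

/-- Here the left coideal property of F(H) enters: in a ⊗ 1 = ∑ (1 ⊗ a₍₂₎)ψ(a₍₁₎) the elements a₍₂₎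
can be taken in F(H). -/
theorem tmul_one_mem_smash (a : locallyFinite k H) : (a : H) ⊗ₜ 1 ∈ smash k H := by
  obtain ⟨t, ht⟩ := exists_lTensor_eq_comul k a
  exact ⟨t, locFinPsiMul_of_lTensor_eq_comul k ht⟩

theorem one_tmul_mem_smash (b : locallyFinite k H) :
    1 ⊗ₜ MulOpposite.op (b : H) ∈ smash k H :=
  ⟨1 ⊗ₜ b, by simp⟩

theorem tmul_mem_smash (a b : locallyFinite k H) :
    (a : H) ⊗ₜ MulOpposite.op (b : H) ∈ smash k H := by
  simpa using mul_mem (tmul_one_mem_smash k a) (one_tmul_mem_smash k b)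

/-- `ψ(c)` as an element of `smash k H`. -/
noncomputable def smashPsi : H →ₐ[k] smash k H := (psi k H).codRestrict _ (psi_mem_smash k)

/-- `a ⊗ 1` as an element of `smash k H`. -/
noncomputable def smashLeft : locallyFinite k H →ₐ[k] smash k H :=
  ((includeLeft (R := k) (S := k) (A := H) (B := Hᵐᵒᵖ)).comp (locallyFinite k H).val).codRestrict _
    (tmul_one_mem_smash k)

/-- `1 ⊗ b` as an element of `smash k H`. -/
noncomputable def smashRight : (locallyFinite k H)ᵐᵒᵖ →ₐ[k] smash k H :=
  ((includeRight (R := k) (A := H) (B := Hᵐᵒᵖ)).comp (AlgHom.op (locallyFinite k H).val)).codRestrict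
    _ (fun b => one_tmul_mem_smash k b.unop)

@[simp] theorem coe_smashPsi (c : H) : (smashPsi k c : H ⊗[k] Hᵐᵒᵖ) = psi k H c := rfl
@[simp] theorem coe_smashLeft (a : locallyFinite k H) :
    (smashLeft k a : H ⊗[k] Hᵐᵒᵖ) = (a : H) ⊗ₜ 1 := rfl
@[simp] theorem coe_smashRight (b : (locallyFinite k H)ᵐᵒᵖ) :
    (smashRight k b : H ⊗[k] Hᵐᵒᵖ) = 1 ⊗ₜ MulOpposite.op (b.unop : H) := rfl

variable (H) in
/-- The linear isomorphism `H ⊗ F(H) ≃ (1 ⊗ F(H)) ψ(H)`. -/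
noncomputable def smashEquiv : H ⊗[k] locallyFinite k H ≃ₗ[k] smash k H :=
  LinearEquiv.ofInjective (locFinPsiMul k H) (locFinPsiMul_injective k)

theorem smashEquiv_tmul (u : H) (b : locallyFinite k H) :
    smashEquiv k H (u ⊗ₜ b) = smashRight k (.op b) * smashPsi k u := rfl

theorem smashEquiv_mul {ι : Type*} {u : H} (r : Coalgebra.Repr k u ι) (u' : H)
    (b b' : locallyFinite k H) :
    smashEquiv k H (u ⊗ₜ b) * smashEquiv k H (u' ⊗ₜ b') =
      smashEquiv k H (∑ i ∈ r.index, (r.left i * u') ⊗ₜ (adF k H (r.right i) b' * b)) :=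
  Subtype.ext (locFinPsiMul_mul k r u' b b')

theorem smashPsi_eq (c : H) : smashPsi k c = smashEquiv k H (c ⊗ₜ 1) := by
  rw [smashEquiv_tmul, MulOpposite.op_one, map_one, one_mul]

theorem smashRight_eq (b : locallyFinite k H) :
    smashRight k (.op b) = smashEquiv k H (1 ⊗ₜ b) := by
  rw [smashEquiv_tmul, map_one, mul_one]

/-- `ψ(a) (b ⊗ c) = ∑ ((ad a₍₁₎) b ⊗ (ad a₍₃₎) c) ψ(a₍₂₎)`. -/
theorem psi_mul_tmul_tmul (a b c : H) {n : ℕ} (x y z : Fin n → H)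
    (h : ∑ i, x i ⊗ₜ[k] (y i ⊗ₜ[k] z i) = Coalgebra.comul.lTensor H (Coalgebra.comul a)) :
    psi k H a * ((b ⊗ₜ 1) * (1 ⊗ₜ MulOpposite.op c)) =
      ∑ i, (ad k H (x i) b ⊗ₜ 1) * ((1 ⊗ₜ MulOpposite.op (ad k H (z i) c)) * psi k H (y i)) := by
  -- `Ξ` sends x ⊗ (y ⊗ z) to the corresponding summand of the right side, so the sum depends only
  -- on the tensor and the given expansion may be replaced by the iterated coproduct.
  let Ξ : H ⊗[k] (H ⊗[k] H) →ₗ[k] H ⊗[k] Hᵐᵒᵖ := LinearMap.mul' k _ ∘ₗ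
    TensorProduct.map ((includeLeft (R := k) (S := k) (A := H) (B := Hᵐᵒᵖ)).toLinearMap ∘ₗ
      (ad k H).toLinearMap.flip b) (psiMul k ∘ₗ ((ad k H).toLinearMap.flip c).lTensor H)
  have h2 := congrArg Ξ h
  let r := Coalgebra.Repr.arbitrary k a
  rw [map_sum, ← r.eq, map_sum, map_sum] at h2
  rw [← mul_assoc, psi_mul_tmul_left k r, Finset.sum_mul]
  simp only [mul_assoc, psi_mul_tmul_right]
  exact h2.symm

/-- This and the next two lemmas are the axioms of `CompatibleBimodule` as identities inside the
algebra; any representation then satisfies them. -/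
theorem smashPsi_mul (a : H) (b c : locallyFinite k H) {n : ℕ} (x y z : Fin n → H)
    (h : ∑ i, x i ⊗ₜ[k] (y i ⊗ₜ[k] z i) = Coalgebra.comul.lTensor H (Coalgebra.comul a)) :
    smashPsi k a * (smashLeft k b * smashRight k (.op c)) =
      ∑ i, smashLeft k (adF k H (x i) b) *
        (smashRight k (.op (adF k H (z i) c)) * smashPsi k (y i)) := by
  apply Subtype.ext
  simpa using psi_mul_tmul_tmul k a b c x y z h

theorem smashLeft_eq (a : locallyFinite k H) {n : ℕ} (x : Fin n → H)
    (y : Fin n → locallyFinite k H)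
    (h : ∑ i, x i ⊗ₜ[k] (y i : H) = Coalgebra.comul (a : H)) :
    smashLeft k a = smashEquiv k H (∑ i, x i ⊗ₜ[k] y i) :=
  Subtype.ext (locFinPsiMul_of_lTensor_eq_comul k (by simpa using h)).symm

theorem smashLeft_mul_smashRight_comm (a b : locallyFinite k H) :
    smashLeft k a * smashRight k (.op b) = smashRight k (.op b) * smashLeft k a :=
  Subtype.ext (by simp)

end HopfAd

/-! ### Modules over the smash product and compatible bimodules. -/

namespace HopfAd

open Algebra.TensorProduct

variable (k : Type*) {H : Type*} [Field k] [Ring H] [HopfAlgebra k H]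

namespace CompatibleBimodule

variable {k} {M N : Type*} [AddCommGroup M] [Module k M] [AddCommGroup N] [Module k N]

theorem ext' {B B' : CompatibleBimodule k H M} (h1 : B.left = B'.left) (h2 : B.right = B'.right)
    (h3 : B.adj = B'.adj) : B = B' := by
  cases B; cases B'; congr

variable (B : CompatibleBimodule k H M)

/-- `(ad a)(m · c) = ∑ (ad a₍₁₎)m · (ad a₍₂₎)c`. -/
theorem adj_mul_right {ι : Type*} {a : H} (r : Coalgebra.Repr k a ι) (c : locallyFinite k H) :
    B.adj a * B.right (.op c) =
      ∑ i ∈ r.index, B.right (.op (adF k H (r.right i) c)) * B.adj (r.left i) := by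
  ext m
  let f : H ⊗[k] H →ₗ[k] M := TensorProduct.lift (LinearMap.mk₂ k
    (fun y z => B.right (.op (adF k H z c)) (B.adj y m)) (by intros; simp)
    (by intros; simp) (by intros; simp) (by intros; simp))
  obtain ⟨n, x, y, z, h⟩ :=
    exists_fin_sum_tmul_tmul k (Coalgebra.comul.lTensor H (Coalgebra.comul (R := k) a))
  -- Taking b = 1, the factor (ad x)1 is the scalar ε(x), so the counit collapses the first leg of
  -- the iterated coproduct and leaves Δ(a).
  have h1 := B.adj_bimodule a 1 c m x y z h
  have h2 := congrArg (fun t => f (TensorProduct.lid k _ (Coalgebra.counit.rTensor _ t))) h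
  rw [lid_rTensor_comm, Coalgebra.rTensor_counit_comul, TensorProduct.lid_tmul, one_smul,
    ← r.eq] at h2
  have had (x : H) : adF k H x 1 = algebraMap k _ (Coalgebra.counit x) :=
    Subtype.ext (ad_one k x)
  simp only [had, AlgHom.commutes, map_one, Module.algebraMap_end_apply, Module.End.one_apply]
    at h1
  simp only [map_sum, LinearMap.rTensor_tmul, TensorProduct.lid_tmul, map_smul] at h2
  rw [Module.End.mul_apply, h1, LinearMap.sum_apply]
  exact h2

/-- The linear map `u ⊗ b ↦ (m ↦ (ad u)m · b)`. -/
noncomputable def smashAct : H ⊗[k] locallyFinite k H →ₗ[k] Module.End k M :=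
  TensorProduct.lift (LinearMap.mk₂ k (fun u b => B.right (.op b) * B.adj u)
    (by intros; simp [mul_add]) (by intros; rw [map_smul, mul_smul_comm])
    (by intros; simp [add_mul]) (by intros; rw [MulOpposite.op_smul, map_smul, smul_mul_assoc]))

@[simp]
theorem smashAct_tmul (u : H) (b : locallyFinite k H) :
    B.smashAct (u ⊗ₜ b) = B.right (.op b) * B.adj u := rfl

/-- The computation of `locFinPsiMul_mul` repeated for operators on `M`, with `adj_mul_right` as the
straightening rule; it makes the action multiplicative. -/
theorem smashAct_mul {ι : Type*} {u : H} (r : Coalgebra.Repr k u ι) (u' : H)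
    (b b' : locallyFinite k H) :
    B.smashAct (∑ i ∈ r.index, (r.left i * u') ⊗ₜ (adF k H (r.right i) b' * b)) =
      B.smashAct (u ⊗ₜ b) * B.smashAct (u' ⊗ₜ b') := by
  rw [smashAct_tmul, smashAct_tmul, mul_assoc, ← mul_assoc (B.adj u), B.adj_mul_right r,
    Finset.sum_mul, Finset.mul_sum, map_sum]
  refine Finset.sum_congr rfl fun i _ => ?_
  rw [smashAct_tmul, MulOpposite.op_mul, map_mul, map_mul]
  simp only [mul_assoc]

/-- The action of `(1 ⊗ F(H)) ψ(H)` on a bimodule with compatible `ad H`-action. -/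
noncomputable def toSmash : smash k H →ₐ[k] Module.End k M :=
  AlgHom.ofLinearMap (B.smashAct ∘ₗ (smashEquiv k H).symm.toLinearMap)
    (by
      have : (1 : smash k H) = smashEquiv k H (1 ⊗ₜ 1) := by
        rw [← smashPsi_eq, map_one]
      simp [this])
    (by
      intro s t
      obtain ⟨s, rfl⟩ := (smashEquiv k H).surjective s
      obtain ⟨t, rfl⟩ := (smashEquiv k H).surjective t
      induction s with
      | zero => simp
      | add s s' hs hs' => simp only [map_add, add_mul, hs, hs']
      | tmul u b =>
        induction t with
        | zero => simp
        | add s s' hs hs' => simp only [map_add, mul_add, hs, hs']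
        | tmul u' b' =>
          rw [smashEquiv_mul k (Coalgebra.Repr.arbitrary k u)]
          simp only [LinearMap.comp_apply, LinearEquiv.coe_coe, LinearEquiv.symm_apply_apply]
          exact B.smashAct_mul _ _ _ _)

@[simp]
theorem toSmash_smashEquiv (t : H ⊗[k] locallyFinite k H) :
    B.toSmash (smashEquiv k H t) = B.smashAct t := by
  simp [toSmash]

@[simp]
theorem toSmash_smashPsi (c : H) : B.toSmash (smashPsi k c) = B.adj c := by
  simp [smashPsi_eq]

@[simp]
theorem toSmash_smashRight (b : (locallyFinite k H)ᵐᵒᵖ) :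
    B.toSmash (smashRight k b) = B.right b := by
  obtain ⟨b, rfl⟩ := MulOpposite.op_surjective b
  simp [smashRight_eq]

@[simp]
-- The action is built from the right and adjoint actions alone; `adj_right` is exactly what
-- identifies a ⊗ 1 = ∑ (1 ⊗ a₍₂₎)ψ(a₍₁₎) with the left action.
theorem toSmash_smashLeft (a : locallyFinite k H) : B.toSmash (smashLeft k a) = B.left a := by
  obtain ⟨t, ht⟩ := exists_lTensor_eq_comul k a
  obtain ⟨n, x, y, rfl⟩ := exists_fin_sum_tmul k t
  have h : ∑ i, x i ⊗ₜ[k] (y i : H) = Coalgebra.comul (a : H) := by simpa using ht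
  rw [smashLeft_eq k a x y h, toSmash_smashEquiv]
  ext m
  rw [← B.adj_right a m x y h]
  simp

variable (k) in
/-- The bimodule with compatible `ad H`-action attached to a module over `(1 ⊗ F(H)) ψ(H)`. -/
noncomputable def ofSmash (ρ : smash k H →ₐ[k] Module.End k M) : CompatibleBimodule k H M where
  left := ρ.comp (smashLeft k)
  right := ρ.comp (smashRight k)
  adj := ρ.comp (smashPsi k)
  left_right_comm a b m := by
    simp only [AlgHom.comp_apply, ← Module.End.mul_apply, ← map_mul,
      smashLeft_mul_smashRight_comm]
  adj_bimodule a b c m n x y z h := by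
    simp only [AlgHom.comp_apply, ← Module.End.mul_apply, ← map_mul]
    rw [smashPsi_mul k a b c x y z h, map_sum, LinearMap.sum_apply]
  adj_right a m n x y h := by
    simp only [AlgHom.comp_apply, ← Module.End.mul_apply, ← map_mul]
    rw [smashLeft_eq k a x y h, map_sum, map_sum, LinearMap.sum_apply]
    simp only [smashEquiv_tmul]

variable (k H M) in
/-- Bimodules with compatible `ad H`-action are the same as modules over `(1 ⊗ F(H)) ψ(H)`. -/
noncomputable def smashModuleEquiv : CompatibleBimodule k H M ≃ (smash k H →ₐ[k] Module.End k M) where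
  toFun B := B.toSmash
  invFun ρ := ofSmash k ρ
  left_inv B := ext' (by ext; simp [ofSmash]) (by ext; simp [ofSmash]) (by ext; simp [ofSmash])
  right_inv ρ := by
    -- The products (1 ⊗ b)ψ(u) span the algebra, so `ρ` is determined by its values on the two
    -- kinds of factors.
    refine AlgHom.ext fun z => ?_
    obtain ⟨t, rfl⟩ := (smashEquiv k H).surjective z
    rw [toSmash_smashEquiv]
    induction t with
    | zero => simp
    | add s t hs ht => simp only [map_add, hs, ht]
    | tmul u b => rw [smashEquiv_tmul, map_mul]; rfl

theorem isHom_iff (B' : CompatibleBimodule k H N) (f : M →ₗ[k] N) :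
    B.IsHom k B' f ↔ ∀ (z : smash k H) (m : M), f (B.toSmash z m) = B'.toSmash z (f m) := by
  constructor
  · intro h z m
    obtain ⟨t, rfl⟩ := (smashEquiv k H).surjective z
    rw [toSmash_smashEquiv, toSmash_smashEquiv]
    induction t with
    | zero => simp
    | add s t hs ht => simp only [map_add, LinearMap.add_apply, hs, ht]
    | tmul u b => simp [h.map_right, h.map_adj]
  · intro h
    exact ⟨fun a m => by simpa using h (smashLeft k a) m,
      fun b m => by simpa using h (smashRight k b) m,
      fun c m => by simpa using h (smashPsi k c) m⟩

end CompatibleBimodule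

/-- Stated for a variable `S` equal to `smash k H`, so that the correspondence transfers by
substitution to a subalgebra defined differently. -/
theorem exists_moduleEquiv (S : Subalgebra k (H ⊗[k] Hᵐᵒᵖ)) (hS : S = smash k H) :
    ∃ Φ : ∀ (M : Type v) [AddCommGroup M] [Module k M],
        CompatibleBimodule k H M ≃ (S →ₐ[k] Module.End k M),
      (∀ (M : Type v) [AddCommGroup M] [Module k M] (B : CompatibleBimodule k H M)
          (a b : locallyFinite k H) (m : M),
        ∃ h : (a : H) ⊗ₜ[k] MulOpposite.op (b : H) ∈ S,
          Φ M B ⟨_, h⟩ m = B.left a (B.right (MulOpposite.op b) m)) ∧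
      (∀ (M : Type v) [AddCommGroup M] [Module k M] (B : CompatibleBimodule k H M)
          (c : H) (m : M),
        ∃ h : psi k H c ∈ S, Φ M B ⟨_, h⟩ m = B.adj c m) ∧
      (∀ (M N : Type v) [AddCommGroup M] [Module k M] [AddCommGroup N] [Module k N]
          (B : CompatibleBimodule k H M) (B' : CompatibleBimodule k H N)
          (f : M →ₗ[k] N),
        B.IsHom k B' f ↔ ∀ (z : S) (m : M), f (Φ M B z m) = Φ N B' z (f m)) := by
  subst hS
  refine ⟨fun M _ _ => CompatibleBimodule.smashModuleEquiv k H M, ?_, ?_, ?_⟩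
  · intro M _ _ B a b m
    refine ⟨tmul_mem_smash k a b, ?_⟩
    have : (⟨_, tmul_mem_smash k a b⟩ : smash k H) = smashLeft k a * smashRight k (.op b) :=
      Subtype.ext (by simp)
    change B.toSmash _ m = _
    rw [this, map_mul, B.toSmash_smashLeft, B.toSmash_smashRight, Module.End.mul_apply]
  · intro M _ _ B c m
    exact ⟨psi_mem_smash k c, LinearMap.congr_fun (B.toSmash_smashPsi c) m⟩
  · intro M N _ _ _ _ B B' f
    exact B.isHom_iff B' f

/-! ### Identification of the smash product with F(H ⊗ Hᵒᵖ)ψ(H). -/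

section LocFinPsi

variable (h : Function.Bijective (HopfAlgebra.antipode k (A := H)))

theorem locallyFinite_le_smash :
    letI := hopfAlgebraOp k h
    locallyFinite k (H ⊗[k] Hᵐᵒᵖ) ≤ smash k H := by
  let := hopfAlgebraOp k h
  intro v hv
  obtain ⟨t, rfl⟩ := locallyFinite_tensorProduct k hv
  clear hv
  induction t with
  | zero => rw [map_zero]; exact zero_mem _
  | add s t hs ht => rw [map_add]; exact add_mem hs ht
  | tmul a b => exact tmul_mem_smash k a ⟨_, (op_mem_locallyFinite k h _).1 b.2⟩

/-- For b in F(H), the element 1 ⊗ b is itself locally finite in H ⊗ Hᵒᵖ, so each spanning product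
(1 ⊗ b)ψ(u) already has the form fr. -/
theorem smash_le_mul :
    letI := hopfAlgebraOp k h
    Subalgebra.toSubmodule (smash k H) ≤
      Subalgebra.toSubmodule (locallyFinite k (H ⊗[k] Hᵐᵒᵖ)) *
        Subalgebra.toSubmodule (psi k H).range := by
  let := hopfAlgebraOp k h
  rintro _ ⟨t, rfl⟩
  induction t with
  | zero => rw [map_zero]; exact zero_mem _
  | add s t hs ht => rw [map_add]; exact add_mem hs ht
  | tmul u b =>
    exact Submodule.mul_mem_mul
      (tmul_mem_locallyFinite k (one_mem _) ((op_mem_locallyFinite k h _).2 b.2)) ⟨u, rfl⟩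

theorem locallyFinite_sup_psi_range :
    letI := hopfAlgebraOp k h
    locallyFinite k (H ⊗[k] Hᵐᵒᵖ) ⊔ (psi k H).range = smash k H := by
  let := hopfAlgebraOp k h
  refine le_antisymm (sup_le (locallyFinite_le_smash k h) ?_) fun x hx => ?_
  · rintro _ ⟨c, rfl⟩
    exact psi_mem_smash k c
  · exact Submodule.mul_le (P := Subalgebra.toSubmodule
      (locallyFinite k (H ⊗[k] Hᵐᵒᵖ) ⊔ (psi k H).range)).2 (fun a ha b hb =>
        Subalgebra.mul_mem _ ((le_sup_left : locallyFinite k (H ⊗[k] Hᵐᵒᵖ) ≤ _) ha)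
          ((le_sup_right : (psi k H).range ≤ _) hb)) (smash_le_mul k h hx)

theorem toSubmodule_smash_eq_mul :
    letI := hopfAlgebraOp k h
    Subalgebra.toSubmodule (smash k H) =
      Subalgebra.toSubmodule (locallyFinite k (H ⊗[k] Hᵐᵒᵖ)) *
        Subalgebra.toSubmodule (psi k H).range := by
  let := hopfAlgebraOp k h
  refine le_antisymm (smash_le_mul k h) (Submodule.mul_le.2 fun a ha b hb => ?_)
  obtain ⟨c, rfl⟩ := hb
  exact mul_mem (S := Subalgebra k _) (locallyFinite_le_smash k h ha) (psi_mem_smash k c)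

end LocFinPsi

end HopfAd

/-- Beyond its Hopf algebra structure, all that is needed of U_q(𝔤) is the bijectivity of its
antipode. -/
theorem CartanDatum.locFinPsi_eq_smash {ι : Type*} [Fintype ι] (C : CartanDatum ι) :
    C.locFinPsi = HopfAd.smash Cq C.Uq :=
  HopfAd.locallyFinite_sup_psi_range Cq (CartanDatum.Uq.antipode_bijective C)

theorem theorem5p5 {ι : Type u} [Fintype ι] (C : CartanDatum ι) :
    Subalgebra.toSubmodule C.locFinPsi =
        Subalgebra.toSubmodule (HopfAd.locallyFinite Cq (C.Uq ⊗[Cq] C.Uqᵐᵒᵖ)) *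
          Subalgebra.toSubmodule (HopfAd.psi Cq C.Uq).range ∧
      ∃ Φ : ∀ (M : Type v) [AddCommGroup M] [Module Cq M],
          HopfAd.CompatibleBimodule Cq C.Uq M ≃ (C.locFinPsi →ₐ[Cq] Module.End Cq M),
        (∀ (M : Type v) [AddCommGroup M] [Module Cq M] (B : HopfAd.CompatibleBimodule Cq C.Uq M)
            (a b : HopfAd.locallyFinite Cq C.Uq) (m : M),
          ∃ h : (a : C.Uq) ⊗ₜ[Cq] MulOpposite.op (b : C.Uq) ∈ C.locFinPsi,
            Φ M B ⟨_, h⟩ m = B.left a (B.right (MulOpposite.op b) m)) ∧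
        (∀ (M : Type v) [AddCommGroup M] [Module Cq M] (B : HopfAd.CompatibleBimodule Cq C.Uq M)
            (c : C.Uq) (m : M),
          ∃ h : HopfAd.psi Cq C.Uq c ∈ C.locFinPsi, Φ M B ⟨_, h⟩ m = B.adj c m) ∧
        (∀ (M N : Type v) [AddCommGroup M] [Module Cq M] [AddCommGroup N] [Module Cq N]
            (B : HopfAd.CompatibleBimodule Cq C.Uq M) (B' : HopfAd.CompatibleBimodule Cq C.Uq N)
            (f : M →ₗ[Cq] N),
          B.IsHom Cq B' f ↔ ∀ (z : C.locFinPsi) (m : M), f (Φ M B z m) = Φ N B' z (f m)) := by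
  refine ⟨?_, HopfAd.exists_moduleEquiv Cq _ C.locFinPsi_eq_smash⟩
  rw [C.locFinPsi_eq_smash]
  exact HopfAd.toSubmodule_smash_eq_mul Cq (CartanDatum.Uq.antipode_bijective C)
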